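/- Let $f\colon\Sigma\to\mathbb{R}^4$ be a smooth immersion of a smooth surface $\Sigma$ (a Hausdorff smooth $2$-manifold without boundary), and assume that $\Sigma$ is complete in the Riemannian metric induced by $f$. Let $\Pi\subset\mathbb{R}^4$ be a two-dimensional linear subspace and let $0<\theta_1<\theta_2<\frac{\pi}{2}$. Suppose that for every $p\in\Sigma$ the principal angles between the tangent plane $df_p(T_p\Sigma)\subset\mathbb{R}^4$ and $\Pi$ are $\theta_1$ and $\theta_2$. Then $\Sigma$ is totally geodesic, i.e. its second fundamental form vanishes identically. Here the principal angles $0\le\theta_1\le\theta_2\le\frac{\pi}{2}$ between two-dimensional subspaces $V,W\subset\mathbb{R}^4$ are defined by $$\cos\theta_1=\langle v_1,w_1\rangle=\max\{\langle v,w\rangle : v\in V,\ w\in W,\ |v|=|w|=1\},$$ $$\cos\theta_2=\max\{\langle v,w\rangle : v\in V,\ w\in W,\ v\perp v_1,\ w\perp w_1,\ |v|=|w|=1\}.$$ -/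

import Mathlib

open Set Filter Topology MeasureTheory
open scoped Manifold ContDiff ENNReal

attribute [local instance 2000] chartedSpaceSelf

noncomputable section

namespace ConstantAngleSurface

/-- `θ₁` and `θ₂` are the principal angles `0 ≤ θ₁ ≤ θ₂ ≤ π / 2` between the planes `V` and `W`
of `ℝ⁴`: `cos θ₁ = ⟪v₁, w₁⟫` is the maximum of `⟪v, w⟫` over unit vectors `v ∈ V`, `w ∈ W`, and
`cos θ₂` is the maximum of `⟪v, w⟫` over unit vectors `v ∈ V`, `w ∈ W` with `v ⟂ v₁`, `w ⟂ w₁`. -/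
def ArePrincipalAngles (V W : Submodule ℝ (EuclideanSpace ℝ (Fin 4))) (θ₁ θ₂ : ℝ) : Prop :=
  0 ≤ θ₁ ∧ θ₁ ≤ θ₂ ∧ θ₂ ≤ Real.pi / 2 ∧
    ∃ v₁ ∈ V, ∃ w₁ ∈ W, ‖v₁‖ = 1 ∧ ‖w₁‖ = 1 ∧ inner ℝ v₁ w₁ = Real.cos θ₁ ∧
      IsGreatest {c : ℝ | ∃ v ∈ V, ∃ w ∈ W, ‖v‖ = 1 ∧ ‖w‖ = 1 ∧ c = inner ℝ v w} (Real.cos θ₁) ∧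
      IsGreatest {c : ℝ | ∃ v ∈ V, ∃ w ∈ W, inner ℝ v v₁ = 0 ∧ inner ℝ w w₁ = 0 ∧
        ‖v‖ = 1 ∧ ‖w‖ = 1 ∧ c = inner ℝ v w} (Real.cos θ₂)

section Surface

variable {M : Type*} [TopologicalSpace M] [ChartedSpace (EuclideanSpace ℝ (Fin 2)) M]

/-- The differential of `f : M → ℝ⁴` at `p`. The tangent space of `M` at `p` is identified with
`ℝ²` by the preferred chart at `p`. -/
def differential (f : M → EuclideanSpace ℝ (Fin 4)) (p : M) :
    EuclideanSpace ℝ (Fin 2) →L[ℝ] EuclideanSpace ℝ (Fin 4) :=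
  mfderiv (𝓡 2) (𝓡 4) f p

/-- A smooth immersion of the surface `M` into `ℝ⁴`. -/
def IsSmoothImmersion (f : M → EuclideanSpace ℝ (Fin 4)) : Prop :=
  ContMDiff (𝓡 2) (𝓡 4) ∞ f ∧ ∀ p, Function.Injective (differential f p)

/-- The tangent plane of the immersed surface at `p`, as a linear subspace of `ℝ⁴`. -/
def tangentPlane (f : M → EuclideanSpace ℝ (Fin 4)) (p : M) :
    Submodule ℝ (EuclideanSpace ℝ (Fin 4)) :=
  LinearMap.range (differential f p : EuclideanSpace ℝ (Fin 2) →ₗ[ℝ] EuclideanSpace ℝ (Fin 4))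

/-- The immersed surface has constant principal angles `θ₁`, `θ₂` with respect to the plane `Pl`. -/
def HasConstantPrincipalAngles (f : M → EuclideanSpace ℝ (Fin 4))
    (Pl : Submodule ℝ (EuclideanSpace ℝ (Fin 4))) (θ₁ θ₂ : ℝ) : Prop :=
  ∀ p, ArePrincipalAngles (tangentPlane f p) Pl θ₁ θ₂

/-- The distance of the metric on `M` induced by `f`: the infimum of the lengths of `C¹` curves in
`M` from `x` to `y`, where the length of a curve `γ` is the Euclidean length of `f ∘ γ`. -/
def inducedEDist (f : M → EuclideanSpace ℝ (Fin 4)) (x y : M) : ℝ≥0∞ :=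
  ⨅ (γ : ℝ → M) (_ : ContMDiffOn 𝓘(ℝ, ℝ) (𝓡 2) 1 γ (Icc 0 1)) (_ : γ 0 = x) (_ : γ 1 = y),
    ∫⁻ t in Ioo (0 : ℝ) 1, ‖deriv (f ∘ γ) t‖ₑ

/-- The immersed surface is complete in its induced metric: every Cauchy sequence for the induced
distance converges. -/
def IsCompleteSurface (f : M → EuclideanSpace ℝ (Fin 4)) : Prop :=
  ∀ u : ℕ → M,
    (∀ ε : ℝ≥0∞, 0 < ε → ∃ N : ℕ, ∀ m ≥ N, ∀ n ≥ N, inducedEDist f (u m) (u n) < ε) →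
      ∃ x : M, Tendsto u atTop (𝓝 x)

/-- The second fundamental form `α(v, w)` at `p`: the component normal to the surface of the
second derivative of `f`, read in the preferred chart at `p`. -/
def secondFundamentalForm (f : M → EuclideanSpace ℝ (Fin 4)) (p : M)
    (v w : EuclideanSpace ℝ (Fin 2)) : EuclideanSpace ℝ (Fin 4) :=
  (tangentPlane f p)ᗮ.starProjection
    (fderiv ℝ (fderiv ℝ (f ∘ (extChartAt (𝓡 2) p).symm)) (extChartAt (𝓡 2) p p) v w)

/-- The immersed surface is totally geodesic: its second fundamental form vanishes. -/
def IsTotallyGeodesic (f : M → EuclideanSpace ℝ (Fin 4)) : Prop :=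
  ∀ p v w, secondFundamentalForm f p v w = 0

end Surface

end ConstantAngleSurface

end

namespace ConstantAngleSurface

section InducedDistance

variable {M : Type*} [TopologicalSpace M] [ChartedSpace (EuclideanSpace ℝ (Fin 2)) M]

/-- The norm on the tangent spaces induced by `f`. -/
noncomputable abbrev inducedENorm (f : M → EuclideanSpace ℝ (Fin 4)) (x : M) : ENorm (TangentSpace (𝓡 2) x) :=
  ⟨fun v ↦ ‖differential f x v‖ₑ⟩

theorem enorm_deriv_comp {f : M → EuclideanSpace ℝ (Fin 4)} (hf : IsSmoothImmersion f)
    {γ : ℝ → M} {t : ℝ} (hγ : MDifferentiableAt 𝓘(ℝ, ℝ) (𝓡 2) γ t) :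
    ‖deriv (f ∘ γ) t‖ₑ = ‖differential f (γ t) (mfderiv 𝓘(ℝ, ℝ) (𝓡 2) γ t (1 : ℝ))‖ₑ := by
  have hfd : MDifferentiableAt (𝓡 2) (𝓡 4) f (γ t) := (hf.1 (γ t)).mdifferentiableAt (by simp)
  have h : (fderiv ℝ (f ∘ γ) t : ℝ →L[ℝ] EuclideanSpace ℝ (Fin 4)) =
      (differential f (γ t)).comp
        (show ℝ →L[ℝ] EuclideanSpace ℝ (Fin 2) from mfderiv 𝓘(ℝ, ℝ) (𝓡 2) γ t) := by
    rw [← mfderiv_eq_fderiv]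
    exact mfderiv_comp t hfd hγ
  rw [← fderiv_apply_one_eq_deriv, h]
  rfl

theorem inducedEDist_eq_riemannianEDist {f : M → EuclideanSpace ℝ (Fin 4)}
    (hf : IsSmoothImmersion f) (x y : M) :
    let := inducedENorm f
    inducedEDist f x y = Manifold.riemannianEDist (𝓡 2) x y := by
  let := inducedENorm f
  have : ∀ x : M, ENormSMulClass ℝ (TangentSpace (𝓡 2) x) := fun x ↦ ⟨fun c v ↦ by
    change ‖differential f x (c • v)‖ₑ = ‖c‖ₑ * ‖differential f x v‖ₑ
    exact (congrArg enorm ((differential f x).map_smul c v)).trans (enorm_smul _ _)⟩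
  have key : ∀ γ : ℝ → M, ContMDiffOn 𝓘(ℝ, ℝ) (𝓡 2) 1 γ (Icc 0 1) →
      ∫⁻ t in Ioo (0 : ℝ) 1, ‖deriv (f ∘ γ) t‖ₑ = Manifold.pathELength (𝓡 2) γ 0 1 := by
    intro γ hγ
    rw [Manifold.pathELength_eq_lintegral_mfderiv_Ioo]
    refine setLIntegral_congr_fun measurableSet_Ioo fun t ht ↦ ?_
    exact enorm_deriv_comp hf ((hγ.contMDiffAt (Icc_mem_nhds ht.1 ht.2)).mdifferentiableAt
      one_ne_zero)
  apply le_antisymm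
  · refine le_of_forall_gt fun r hr ↦ ?_
    obtain ⟨γ, h0, h1, hγ, hlt⟩ := Manifold.exists_lt_of_riemannianEDist_lt hr
    rw [← key γ hγ] at hlt
    exact lt_of_le_of_lt (iInf_le_of_le γ <| iInf_le_of_le hγ <| iInf_le_of_le h0 <|
      iInf_le _ h1) hlt
  · refine le_iInf fun γ ↦ le_iInf fun hγ ↦ le_iInf fun h0 ↦ le_iInf fun h1 ↦ ?_
    rw [key γ hγ]
    exact Manifold.riemannianEDist_le_pathELength hγ h0 h1 zero_le_one

theorem inducedEDist_triangle {f : M → EuclideanSpace ℝ (Fin 4)} (hf : IsSmoothImmersion f)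
    (x y z : M) : inducedEDist f x z ≤ inducedEDist f x y + inducedEDist f y z := by
  let := inducedENorm f
  have : ∀ x : M, ENormSMulClass ℝ (TangentSpace (𝓡 2) x) := fun x ↦ ⟨fun c v ↦ by
    change ‖differential f x (c • v)‖ₑ = ‖c‖ₑ * ‖differential f x v‖ₑ
    exact (congrArg enorm ((differential f x).map_smul c v)).trans (enorm_smul _ _)⟩
  simp only [inducedEDist_eq_riemannianEDist hf]
  exact Manifold.riemannianEDist_triangle

theorem inducedEDist_comm {f : M → EuclideanSpace ℝ (Fin 4)} (hf : IsSmoothImmersion f)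
    (x y : M) : inducedEDist f x y = inducedEDist f y x := by
  let := inducedENorm f
  have : ∀ x : M, ENormSMulClass ℝ (TangentSpace (𝓡 2) x) := fun x ↦ ⟨fun c v ↦ by
    change ‖differential f x (c • v)‖ₑ = ‖c‖ₑ * ‖differential f x v‖ₑ
    exact (congrArg enorm ((differential f x).map_smul c v)).trans (enorm_smul _ _)⟩
  simp only [inducedEDist_eq_riemannianEDist hf]
  exact Manifold.riemannianEDist_comm

variable [IsManifold (𝓡 2) ∞ M]

/-- The map `f` read in the preferred chart at `x`. -/
noncomputable abbrev chartRep {N : Type*} (f : M → N) (x : M) : EuclideanSpace ℝ (Fin 2) → N :=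
  f ∘ (extChartAt (𝓡 2) x).symm

theorem contMDiffAt_extChartAt_symm' (x : M) {u : EuclideanSpace ℝ (Fin 2)}
    (hu : u ∈ (extChartAt (𝓡 2) x).target) :
    ContMDiffAt (𝓡 2) (𝓡 2) ∞ (extChartAt (𝓡 2) x).symm u :=
  (contMDiffOn_extChartAt_symm x).contMDiffAt ((isOpen_extChartAt_target x).mem_nhds hu)

theorem contDiffAt_chartRep {f : M → EuclideanSpace ℝ (Fin 4)} (hf : IsSmoothImmersion f)
    (x : M) {u : EuclideanSpace ℝ (Fin 2)} (hu : u ∈ (extChartAt (𝓡 2) x).target) :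
    ContDiffAt ℝ ∞ (chartRep f x) u :=
  contMDiffAt_iff_contDiffAt.1 ((hf.1 _).comp u (contMDiffAt_extChartAt_symm' x hu))

/-- The length of a segment in a chart bounds the induced distance of its end points. -/
theorem inducedEDist_chart_segment_le {f : M → EuclideanSpace ℝ (Fin 4)}
    (hf : IsSmoothImmersion f) (x : M) {u w : EuclideanSpace ℝ (Fin 2)} {C : ℝ}
    (hseg : segment ℝ u w ⊆ (extChartAt (𝓡 2) x).target)
    (hC : ∀ z ∈ segment ℝ u w, ‖fderiv ℝ (chartRep f x) z (w - u)‖ ≤ C) :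
    inducedEDist f ((extChartAt (𝓡 2) x).symm u) ((extChartAt (𝓡 2) x).symm w)
      ≤ ENNReal.ofReal C := by
  set σ : ℝ → EuclideanSpace ℝ (Fin 2) := fun t ↦ u + t • (w - u) with hσ
  have hσseg : ∀ t ∈ Icc (0 : ℝ) 1, σ t ∈ segment ℝ u w := fun t ht ↦ by
    rw [segment_eq_image']; exact ⟨t, ht, rfl⟩
  have hσs : ContDiff ℝ ∞ σ := by fun_prop
  have hγ : ContMDiffOn 𝓘(ℝ, ℝ) (𝓡 2) 1 ((extChartAt (𝓡 2) x).symm ∘ σ) (Icc 0 1) := by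
    intro t ht
    have h1 := (contMDiffAt_extChartAt_symm' x (hseg (hσseg t ht))).comp t
      (contMDiffAt_iff_contDiffAt.2 hσs.contDiffAt)
    exact (h1.of_le (by simp)).contMDiffWithinAt
  have h0 : ((extChartAt (𝓡 2) x).symm ∘ σ) 0 = (extChartAt (𝓡 2) x).symm u := by
    simp only [Function.comp_apply, hσ, zero_smul, add_zero]
  have h1 : ((extChartAt (𝓡 2) x).symm ∘ σ) 1 = (extChartAt (𝓡 2) x).symm w := by
    simp only [Function.comp_apply, hσ, one_smul, add_sub_cancel]
  unfold inducedEDist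
  refine iInf₂_le_of_le _ hγ (iInf₂_le_of_le h0 h1 ?_)
  calc ∫⁻ t in Ioo (0 : ℝ) 1, ‖deriv (f ∘ ((extChartAt (𝓡 2) x).symm ∘ σ)) t‖ₑ
      ≤ ∫⁻ t in Ioo (0 : ℝ) 1, ENNReal.ofReal C := by
        refine setLIntegral_mono measurable_const fun t ht ↦ ?_
        have ht' := hσseg t (Ioo_subset_Icc_self ht)
        have hd : HasDerivAt σ (w - u) t := by
          simpa [hσ] using ((hasDerivAt_id t).smul_const (w - u)).const_add u
        have hF : HasFDerivAt (chartRep f x) (fderiv ℝ (chartRep f x) (σ t)) (σ t) :=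
          ((contDiffAt_chartRep hf x (hseg ht')).differentiableAt (by simp)).hasFDerivAt
        have := (hF.comp_hasDerivAt t hd).deriv
        rw [← Function.comp_assoc, this, ← ofReal_norm]
        exact ENNReal.ofReal_le_ofReal (hC _ ht')
    _ = ENNReal.ofReal C := by simp

end InducedDistance

section Caristi

variable {X : Type*} [TopologicalSpace X]

/-- A form of the Caristi–Ekeland principle: on a complete space, a continuous function `G ≥ 0`
vanishes if from each point with `G > 0` the function `1 / G` can be decreased at a definite rate
with respect to the distance. -/
theorem eq_zero_of_descent (d : X → X → ℝ≥0∞) (hself : ∀ x, d x x = 0)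
    (hcomm : ∀ x y, d x y = d y x) (htri : ∀ x y z, d x z ≤ d x y + d y z)
    (hlim : ∀ x, Tendsto (fun y ↦ d y x) (𝓝 x) (𝓝 0))
    (hcomplete : ∀ u : ℕ → X, (∀ ε : ℝ≥0∞, 0 < ε → ∃ N : ℕ, ∀ m ≥ N, ∀ n ≥ N, d (u m) (u n) < ε) →
      ∃ x : X, Tendsto u atTop (𝓝 x))
    {G : X → ℝ} (hG : Continuous G) (hG0 : ∀ x, 0 ≤ G x)
    (hdesc : ∀ x, 0 < G x → ∃ y, 0 < G y ∧ (G y)⁻¹ < (G x)⁻¹ ∧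
      d x y ≤ ENNReal.ofReal ((G x)⁻¹ - (G y)⁻¹)) (x : X) : G x = 0 := by
  by_contra hne
  have hx0 : 0 < G x := lt_of_le_of_ne (hG0 x) (Ne.symm hne)
  let Y := {x : X // 0 < G x}
  let g : Y → ℝ := fun y ↦ (G y.1)⁻¹
  have hgpos : ∀ y : Y, 0 < g y := fun y ↦ inv_pos.2 y.2
  let R : Y → Y → Prop := fun a b ↦ g b ≤ g a ∧ d a.1 b.1 ≤ ENNReal.ofReal (g a - g b)
  have Rrefl : ∀ a, R a a := fun a ↦ ⟨le_rfl, by simp [hself]⟩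
  have Rtrans : ∀ a b c, R a b → R b c → R a c := fun a b c hab hbc ↦
    ⟨hbc.1.trans hab.1, (htri _ b.1 _).trans ((add_le_add hab.2 hbc.2).trans (by
      rw [← ENNReal.ofReal_add (sub_nonneg.2 hab.1) (sub_nonneg.2 hbc.1)]
      exact ENNReal.ofReal_le_ofReal (by linarith)))⟩
  have hstep : ∀ a : Y, ∃ b, R a b ∧ ∀ c, R a c → 2 * g b - g a ≤ g c := by
    intro a
    have hbdd : BddBelow (g '' {c | R a c}) := ⟨0, by rintro _ ⟨c, -, rfl⟩; exact (hgpos c).le⟩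
    have hmem : g a ∈ g '' {c | R a c} := ⟨a, Rrefl a, rfl⟩
    rcases (csInf_le hbdd hmem).lt_or_eq with h | h
    · obtain ⟨_, ⟨b, hb, rfl⟩, hlt⟩ := exists_lt_of_csInf_lt ⟨_, hmem⟩
        (show sInf (g '' {c | R a c}) < (sInf (g '' {c | R a c}) + g a) / 2 by linarith)
      exact ⟨b, hb, fun c hc ↦ by linarith [csInf_le hbdd ⟨c, hc, rfl⟩]⟩
    · exact ⟨a, Rrefl a, fun c hc ↦ by linarith [csInf_le hbdd ⟨c, hc, rfl⟩]⟩
  choose next hnext1 hnext2 using hstep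
  let u : ℕ → Y := fun n ↦ next^[n] ⟨x, hx0⟩
  have husucc : ∀ n, u (n + 1) = next (u n) := fun n ↦ Function.iterate_succ_apply' _ _ _
  have hR : ∀ m n, m ≤ n → R (u m) (u n) := by
    intro m n hmn
    induction n, hmn using Nat.le_induction with
    | base => exact Rrefl _
    | succ n _ ih => exact Rtrans _ _ _ ih (husucc n ▸ hnext1 _)
  have hanti : Antitone fun n ↦ g (u n) := fun m n hmn ↦ (hR m n hmn).1
  obtain ⟨l, hl⟩ : ∃ l, Tendsto (fun n ↦ g (u n)) atTop (𝓝 l) :=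
    ⟨_, tendsto_atTop_ciInf hanti ⟨0, by rintro _ ⟨n, rfl⟩; exact (hgpos _).le⟩⟩
  have hgel : ∀ n, l ≤ g (u n) := fun n ↦ hanti.le_of_tendsto hl n
  obtain ⟨z, hz⟩ : ∃ z, Tendsto (fun n ↦ (u n).1) atTop (𝓝 z) := by
    refine hcomplete _ fun ε hε ↦ ?_
    obtain ⟨δ, hδ, hδε⟩ : ∃ δ : ℝ, 0 < δ ∧ ENNReal.ofReal δ ≤ ε := by
      obtain ⟨r, hr, hrε⟩ := ENNReal.lt_iff_exists_nnreal_btwn.1 hε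
      exact ⟨r, by simpa using hr, by simpa using hrε.le⟩
    obtain ⟨N, hN⟩ := (hl.eventually (gt_mem_nhds (show l < l + δ by linarith))).exists
    have key : ∀ m ≥ N, ∀ n, m ≤ n → d (u m).1 (u n).1 < ε := fun m hm n hmn ↦ by
      refine lt_of_le_of_lt (hR m n hmn).2 (lt_of_lt_of_le ?_ hδε)
      rw [ENNReal.ofReal_lt_ofReal_iff hδ]
      linarith [hgel n, hanti hm]
    refine ⟨N, fun m hm n hn ↦ ?_⟩
    rcases le_total m n with h | h
    · exact key m hm n h
    · rw [hcomm]; exact key n hn m h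
  have hGz : Tendsto (fun n ↦ G (u n).1) atTop (𝓝 (G z)) := (hG.tendsto z).comp hz
  have hGmono : ∀ n, G x ≤ G (u n).1 := fun n ↦
    (inv_le_inv₀ (u n).2 hx0).1 (hanti (Nat.zero_le n))
  have hzpos : 0 < G z := hx0.trans_le (ge_of_tendsto' hGz hGmono)
  let zY : Y := ⟨z, hzpos⟩
  have hlz : l = g zY := tendsto_nhds_unique hl (hGz.inv₀ hzpos.ne')
  have hRz : ∀ n, R (u n) zY := by
    intro n
    refine ⟨hlz ▸ hgel n, ?_⟩
    have h1 : Tendsto (fun m ↦ ENNReal.ofReal (g (u n) - g (u m)) + d (u m).1 z) atTop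
        (𝓝 (ENNReal.ofReal (g (u n) - g zY) + 0)) :=
      (ENNReal.tendsto_ofReal (tendsto_const_nhds.sub (hlz ▸ hl))).add ((hlim z).comp hz)
    rw [add_zero] at h1
    refine ge_of_tendsto h1 (eventually_atTop.2 ⟨n, fun m hm ↦ ?_⟩)
    exact (htri _ (u m).1 _).trans (add_le_add_left (hR n m hm).2 _)
  obtain ⟨y, hy0, hylt, hyd⟩ := hdesc z hzpos
  have hRy : ∀ n, R (u n) ⟨y, hy0⟩ := fun n ↦ Rtrans _ zY _ (hRz n) ⟨hylt.le, hyd⟩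
  have h2 : Tendsto (fun n ↦ 2 * g (u (n + 1)) - g (u n)) atTop (𝓝 (2 * l - l)) :=
    ((hl.comp (tendsto_add_atTop_nat 1)).const_mul 2).sub hl
  have h3 := le_of_tendsto' h2 fun n ↦ (husucc n ▸ hnext2 (u n) _ (hRy n))
  rw [hlz] at h3
  change (G y)⁻¹ < g zY at hylt
  change _ ≤ (G y)⁻¹ at h3
  linarith

end Caristi

section PrincipalFrame

open scoped InnerProductSpace

variable {E : Type*} [NormedAddCommGroup E] [InnerProductSpace ℝ E]

theorem eq_add_of_orthonormal_pair {W : Submodule ℝ E} (hW : Module.finrank ℝ W = 2) {a b : E}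
    (ha : a ∈ W) (hb : b ∈ W) (ha1 : ‖a‖ = 1) (hb1 : ‖b‖ = 1) (hab : ⟪a, b⟫_ℝ = 0) {z : E}
    (hz : z ∈ W) : z = ⟪a, z⟫_ℝ • a + ⟪b, z⟫_ℝ • b := by
  have ho : Orthonormal ℝ ![(⟨a, ha⟩ : W), ⟨b, hb⟩] := by
    rw [orthonormal_iff_ite]
    intro i j
    fin_cases i <;> fin_cases j <;>
      simp [ha1, hb1, hab, real_inner_comm]
  have : FiniteDimensional ℝ W := Module.finite_of_finrank_eq_succ hW
  let B := OrthonormalBasis.mk ho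
    (ho.linearIndependent.span_eq_top_of_card_eq_finrank (by simp [hW])).ge
  have h := B.sum_repr' ⟨z, hz⟩
  rw [Fin.sum_univ_two] at h
  simpa [B] using (congrArg Subtype.val h).symm

variable {T W : Submodule ℝ E} [W.HasOrthogonalProjection] {c₁ c₂ : ℝ} {e₁ e₂ : E}

/-- `e₁, e₂` is an orthonormal basis of the plane `T` that diagonalizes the restriction to `T` of
the orthogonal projection onto `W`, with eigenvalues `c₁ ^ 2` and `c₂ ^ 2`. -/
structure IsPrincipalFrame (T W : Submodule ℝ E) [W.HasOrthogonalProjection] (c₁ c₂ : ℝ)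
    (e₁ e₂ : E) : Prop where
  mem₁ : e₁ ∈ T
  mem₂ : e₂ ∈ T
  norm₁ : ‖e₁‖ = 1
  norm₂ : ‖e₂‖ = 1
  ortho : ⟪e₁, e₂⟫_ℝ = 0
  repr : ∀ z ∈ T, z = ⟪e₁, z⟫_ℝ • e₁ + ⟪e₂, z⟫_ℝ • e₂
  proj₁ : ⟪W.starProjection e₁, e₁⟫_ℝ = c₁ ^ 2
  proj₂ : ⟪W.starProjection e₂, e₂⟫_ℝ = c₂ ^ 2
  proj₁₂ : ⟪W.starProjection e₁, e₂⟫_ℝ = 0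

theorem inner_starProjection_comm (W : Submodule ℝ E) [W.HasOrthogonalProjection] (a b : E) :
    ⟪W.starProjection a, b⟫_ℝ = ⟪W.starProjection b, a⟫_ℝ := by
  rw [W.inner_starProjection_left_eq_right, real_inner_comm]

theorem inner_starProjection_starProjection (W : Submodule ℝ E) [W.HasOrthogonalProjection]
    (a b : E) : ⟪W.starProjection a, W.starProjection b⟫_ℝ = ⟪W.starProjection a, b⟫_ℝ := by
  rw [← W.inner_starProjection_left_eq_right,
    W.starProjection_eq_self_iff.2 (W.starProjection_apply_mem a)]

namespace IsPrincipalFrame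

theorem swap (h : IsPrincipalFrame T W c₁ c₂ e₁ e₂) : IsPrincipalFrame T W c₂ c₁ e₂ e₁ where
  mem₁ := h.mem₂
  mem₂ := h.mem₁
  norm₁ := h.norm₂
  norm₂ := h.norm₁
  ortho := by rw [real_inner_comm]; exact h.ortho
  repr z hz := by rw [add_comm]; exact h.repr z hz
  proj₁ := h.proj₂
  proj₂ := h.proj₁
  proj₁₂ := by rw [inner_starProjection_comm]; exact h.proj₁₂

theorem inner_self₁ (h : IsPrincipalFrame T W c₁ c₂ e₁ e₂) : ⟪e₁, e₁⟫_ℝ = 1 := by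
  rw [real_inner_self_eq_norm_sq, h.norm₁, one_pow]

theorem inner_self₂ (h : IsPrincipalFrame T W c₁ c₂ e₁ e₂) : ⟪e₂, e₂⟫_ℝ = 1 :=
  h.swap.inner_self₁

theorem ortho' (h : IsPrincipalFrame T W c₁ c₂ e₁ e₂) : ⟪e₂, e₁⟫_ℝ = 0 := h.swap.ortho

theorem neg₁ (h : IsPrincipalFrame T W c₁ c₂ e₁ e₂) : IsPrincipalFrame T W c₁ c₂ (-e₁) e₂ where
  mem₁ := T.neg_mem h.mem₁
  mem₂ := h.mem₂
  norm₁ := by rw [norm_neg, h.norm₁]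
  norm₂ := h.norm₂
  ortho := by rw [inner_neg_left, h.ortho, neg_zero]
  repr z hz := by rw [inner_neg_left, smul_neg, neg_smul, neg_neg]; exact h.repr z hz
  proj₁ := by rw [map_neg, inner_neg_neg, h.proj₁]
  proj₂ := h.proj₂
  proj₁₂ := by rw [map_neg, inner_neg_left, h.proj₁₂, neg_zero]

/-- The projection form in a principal frame, after subtracting `c₁ ^ 2` times the metric. -/
theorem inner_starProjection_sub (h : IsPrincipalFrame T W c₁ c₂ e₁ e₂) {a b : E} (ha : a ∈ T)
    (hb : b ∈ T) : ⟪W.starProjection a, b⟫_ℝ - c₁ ^ 2 * ⟪a, b⟫_ℝ =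
      (c₂ ^ 2 - c₁ ^ 2) * (⟪e₂, a⟫_ℝ * ⟪e₂, b⟫_ℝ) := by
  have ha' := h.repr a ha
  have hb' := h.repr b hb
  generalize ⟪e₁, a⟫_ℝ = a1 at ha'
  generalize h2 : ⟪e₂, a⟫_ℝ = a2 at ha'
  generalize ⟪e₁, b⟫_ℝ = b1 at hb'
  generalize h4 : ⟪e₂, b⟫_ℝ = b2 at hb'
  subst ha' hb'
  simp only [map_add, map_smul, inner_add_left, inner_add_right, real_inner_smul_left,
    real_inner_smul_right, h.proj₁, h.proj₂, h.proj₁₂, h.swap.proj₁₂, h.ortho, h.ortho',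
    h.inner_self₁, h.inner_self₂]
  ring

theorem eq_or_eq_neg_of_norm_eq_one (h : IsPrincipalFrame T W c₁ c₂ e₁ e₂) {e : E} (he : e ∈ T)
    (h1 : ‖e‖ = 1) (h2 : ⟪e₂, e⟫_ℝ = 0) : e = e₁ ∨ e = -e₁ := by
  have hr := h.repr e he
  rw [h2, zero_smul, add_zero] at hr
  have : |⟪e₁, e⟫_ℝ| = 1 := by
    have := congrArg norm hr
    rwa [norm_smul, h.norm₁, h1, mul_one, Real.norm_eq_abs, eq_comm] at this
  rcases (abs_eq zero_le_one).1 this with h' | h'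
  · left; rw [hr, h', one_smul]
  · right; rw [hr, h', neg_one_smul]

theorem eq_or_eq_neg (hc : c₁ ^ 2 ≠ c₂ ^ 2) (h : IsPrincipalFrame T W c₁ c₂ e₁ e₂) {e₁' e₂' : E}
    (h' : IsPrincipalFrame T W c₁ c₂ e₁' e₂') : e₁' = e₁ ∨ e₁' = -e₁ := by
  refine h.eq_or_eq_neg_of_norm_eq_one h'.mem₁ h'.norm₁ ?_
  have := h.inner_starProjection_sub h'.mem₁ h'.mem₁
  rw [h'.proj₁, h'.inner_self₁, mul_one, sub_self, eq_comm, mul_eq_zero] at this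
  exact mul_self_eq_zero.1 (this.resolve_left (sub_ne_zero.2 hc.symm))

theorem mix (hc : c₁ ^ 2 ≠ c₂ ^ 2) {e₁' e₂' : E} (h : IsPrincipalFrame T W c₁ c₂ e₁ e₂')
    (h' : IsPrincipalFrame T W c₁ c₂ e₁' e₂) : IsPrincipalFrame T W c₁ c₂ e₁ e₂ := by
  rcases eq_or_eq_neg hc h h' with rfl | rfl
  · exact h'
  · simpa using h'.neg₁

theorem starProjection_apply [T.HasOrthogonalProjection] (h : IsPrincipalFrame T W c₁ c₂ e₁ e₂)
    (z : E) : T.starProjection z = ⟪e₁, z⟫_ℝ • e₁ + ⟪e₂, z⟫_ℝ • e₂ := by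
  rw [h.repr _ (T.starProjection_apply_mem z)]
  congr 2
  · rw [← T.inner_starProjection_left_eq_right, T.starProjection_eq_self_iff.2 h.mem₁]
  · rw [← T.inner_starProjection_left_eq_right, T.starProjection_eq_self_iff.2 h.mem₂]

end IsPrincipalFrame

theorem inner_eq_zero_of_forall_inner_le {V : Submodule ℝ E} {x a b : E} {c : ℝ} (ha : a ∈ V)
    (hb : b ∈ V) (ha1 : ‖a‖ = 1) (hb1 : ‖b‖ = 1) (hab : ⟪a, b⟫_ℝ = 0) (hxa : ⟪x, a⟫_ℝ = c)
    (hc : 0 ≤ c) (hmax : ∀ y ∈ V, ‖y‖ = 1 → ⟪x, y⟫_ℝ ≤ c) : ⟪x, b⟫_ℝ = 0 := by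
  set z := ⟪x, b⟫_ℝ with hz
  by_contra hne
  have hr : 0 < c ^ 2 + z ^ 2 := by positivity
  have hs := Real.sqrt_pos.2 hr
  have hsq := Real.sq_sqrt hr.le
  set r := √(c ^ 2 + z ^ 2)
  have hn : ‖c • a + z • b‖ = r := by
    rw [← sq_eq_sq₀ (norm_nonneg _) hs.le, norm_add_sq_real, norm_smul, norm_smul,
      real_inner_smul_left, real_inner_smul_right, hab, ha1, hb1, hsq]
    simp
  have h := hmax (r⁻¹ • (c • a + z • b)) (V.smul_mem _ (V.add_mem (V.smul_mem _ ha)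
    (V.smul_mem _ hb))) (by rw [norm_smul, hn, norm_inv, Real.norm_of_nonneg hs.le,
      inv_mul_cancel₀ hs.ne'])
  rw [real_inner_smul_right, inner_add_right, real_inner_smul_right, real_inner_smul_right, hxa,
    ← hz, inv_mul_le_iff₀ hs] at h
  have h2 : r ^ 2 ≤ r * c := by rw [hsq]; nlinarith
  have h3 : r ≤ c := by nlinarith
  have h4 : 0 < z ^ 2 := by positivity
  nlinarith

/-- The principal angles provide a principal frame. -/
theorem exists_isPrincipalFrame {T W : Submodule ℝ (EuclideanSpace ℝ (Fin 4))}
    (hT : Module.finrank ℝ T = 2) (hW : Module.finrank ℝ W = 2) {θ₁ θ₂ : ℝ}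
    (h : ArePrincipalAngles T W θ₁ θ₂) :
    ∃ e₁ e₂, IsPrincipalFrame T W (Real.cos θ₁) (Real.cos θ₂) e₁ e₂ := by
  obtain ⟨h0, h12, h2, v, hv, w, hw, hv1, hw1, hvw, hmax, ⟨v', hv', w', hw', hvv', hww', hv'1,
    hw'1, hv'w'⟩, -⟩ := h
  have hc : 0 ≤ Real.cos θ₁ := Real.cos_nonneg_of_neg_pi_div_two_le_of_le
    (by linarith [Real.pi_pos]) (by linarith)
  rw [real_inner_comm] at hvv' hww'
  have hvw' : ⟪v, w'⟫_ℝ = 0 := inner_eq_zero_of_forall_inner_le hw hw' hw1 hw'1 hww' hvw hc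
    fun y hy hy1 ↦ hmax.2 ⟨v, hv, y, hy, hv1, hy1, rfl⟩
  have hwv' : ⟪w, v'⟫_ℝ = 0 := inner_eq_zero_of_forall_inner_le hv hv' hv1 hv'1 hvv'
    (by rw [real_inner_comm, hvw]) hc
    fun y hy hy1 ↦ hmax.2 ⟨y, hy, w, hw, hy1, hw1, real_inner_comm _ _⟩
  have key : ∀ x y : EuclideanSpace ℝ (Fin 4), ⟪W.starProjection x, y⟫_ℝ =
      ⟪x, w⟫_ℝ * ⟪w, y⟫_ℝ + ⟪x, w'⟫_ℝ * ⟪w', y⟫_ℝ := by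
    intro x y
    rw [eq_add_of_orthonormal_pair hW hw hw' hw1 hw'1 hww' (W.starProjection_apply_mem x),
      inner_add_left, real_inner_smul_left, real_inner_smul_left,
      ← W.inner_starProjection_left_eq_right, ← W.inner_starProjection_left_eq_right,
      W.starProjection_eq_self_iff.2 hw, W.starProjection_eq_self_iff.2 hw', real_inner_comm w,
      real_inner_comm w']
  refine ⟨v, v', hv, hv', hv1, hv'1, hvv',
    fun z hz ↦ eq_add_of_orthonormal_pair hT hv hv' hv1 hv'1 hvv' hz, ?_, ?_, ?_⟩
  · rw [key, real_inner_comm v w, real_inner_comm v w', hvw, hvw']; ring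
  · rw [key, real_inner_comm w v', real_inner_comm v' w', ← hv'w', hwv']; ring
  · rw [key, hwv', hvw']; ring

end PrincipalFrame

section Calculus

open scoped InnerProductSpace

variable {V : Type*} [NormedAddCommGroup V] [NormedSpace ℝ V]
variable {E : Type*} [NormedAddCommGroup E] [InnerProductSpace ℝ E]

theorem contDiffOn_fderiv_apply {G : Type*} [NormedAddCommGroup G] [NormedSpace ℝ G] {U : Set V}
    (hU : IsOpen U) {f : V → G} (hf : ContDiffOn ℝ ∞ f U) (w : V) :
    ContDiffOn ℝ ∞ (fun x ↦ fderiv ℝ f x w) U :=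
  (hf.fderiv_of_isOpen hU (by simp)).clm_apply contDiffOn_const

theorem fderiv_fderiv_apply {G : Type*} [NormedAddCommGroup G] [NormedSpace ℝ G] {f : V → G}
    {u : V} (hf : ContDiffAt ℝ ∞ f u) (v w : V) :
    fderiv ℝ (fun x ↦ fderiv ℝ f x w) u v = fderiv ℝ (fderiv ℝ f) u v w := by
  have hd : DifferentiableAt ℝ (fderiv ℝ f) u :=
    (hf.fderiv_right (m := ∞) (by simp)).differentiableAt (by simp)
  rw [fderiv_clm_apply hd (differentiableAt_const w)]
  simp

theorem fderiv_fderiv_apply_comm {G : Type*} [NormedAddCommGroup G] [NormedSpace ℝ G] {f : V → G}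
    {u : V} (hf : ContDiffAt ℝ ∞ f u) (v w : V) :
    fderiv ℝ (fun x ↦ fderiv ℝ f x w) u v = fderiv ℝ (fun x ↦ fderiv ℝ f x v) u w := by
  rw [fderiv_fderiv_apply hf, fderiv_fderiv_apply hf]
  exact (hf.isSymmSndFDerivAt (by simpa using ENat.LEInfty.out)).eq v w

/-- An orthonormal frame of a fixed plane rotates: its derivative is given by a closed form. -/
theorem exists_rotation_form {W : Submodule ℝ E} [W.HasOrthogonalProjection]
    (hW : Module.finrank ℝ W = 2) {U : Set V} (hU : IsOpen U) {p q : V → E}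
    (hp : ContDiffOn ℝ ∞ p U) (hq : ContDiffOn ℝ ∞ q U) (hpW : ∀ u ∈ U, p u ∈ W)
    (hqW : ∀ u ∈ U, q u ∈ W) (hp1 : ∀ u ∈ U, ⟪p u, p u⟫_ℝ = 1) (hq1 : ∀ u ∈ U, ⟪q u, q u⟫_ℝ = 1)
    (hpq : ∀ u ∈ U, ⟪p u, q u⟫_ℝ = 0) :
    ∃ θ : V → V → ℝ, (∀ u ∈ U, ∀ w, fderiv ℝ p u w = θ u w • q u) ∧
      (∀ u ∈ U, ∀ w, fderiv ℝ q u w = -(θ u w • p u)) ∧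
      (∀ u ∈ U, ∀ w, DifferentiableAt ℝ (fun x ↦ θ x w) u) ∧
      ∀ u ∈ U, ∀ v w, fderiv ℝ (fun x ↦ θ x w) u v = fderiv ℝ (fun x ↦ θ x v) u w := by
  have hmem : ∀ {r : V → E}, ContDiffOn ℝ ∞ r U → (∀ u ∈ U, r u ∈ W) → ∀ u ∈ U, ∀ w,
      fderiv ℝ r u w ∈ W := by
    intro r hr hrW u hu w
    have heq : r =ᶠ[𝓝 u] W.starProjection ∘ r := by
      filter_upwards [hU.mem_nhds hu] with x hx
      exact (W.starProjection_eq_self_iff.2 (hrW x hx)).symm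
    have hd : DifferentiableAt ℝ r u := (hr.contDiffAt (hU.mem_nhds hu)).differentiableAt (by simp)
    rw [heq.fderiv_eq, fderiv_comp u W.starProjection.differentiableAt hd]
    simp only [ContinuousLinearMap.fderiv, ContinuousLinearMap.comp_apply]
    exact W.starProjection_apply_mem _
  have hdi : ∀ {r s : V → E} {c : ℝ}, ContDiffOn ℝ ∞ r U → ContDiffOn ℝ ∞ s U →
      (∀ u ∈ U, ⟪r u, s u⟫_ℝ = c) → ∀ u ∈ U, ∀ w,
      ⟪r u, fderiv ℝ s u w⟫_ℝ + ⟪fderiv ℝ r u w, s u⟫_ℝ = 0 := by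
    intro r s c hr hs h u hu w
    have hd : DifferentiableAt ℝ r u := (hr.contDiffAt (hU.mem_nhds hu)).differentiableAt (by simp)
    have hd' : DifferentiableAt ℝ s u :=
      (hs.contDiffAt (hU.mem_nhds hu)).differentiableAt (by simp)
    have heq : (fun x ↦ ⟪r x, s x⟫_ℝ) =ᶠ[𝓝 u] fun _ ↦ c := by
      filter_upwards [hU.mem_nhds hu] with x hx using h x hx
    rw [← fderiv_inner_apply ℝ hd hd', heq.fderiv_eq]
    simp
  have hnorm : ∀ {x : E}, ⟪x, x⟫_ℝ = 1 → ‖x‖ = 1 := fun {x} h ↦ by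
    rw [real_inner_self_eq_norm_sq] at h
    nlinarith [norm_nonneg x]
  have hDp : ∀ u ∈ U, ∀ w, fderiv ℝ p u w = ⟪q u, fderiv ℝ p u w⟫_ℝ • q u := by
    intro u hu w
    have h := eq_add_of_orthonormal_pair hW (hpW u hu) (hqW u hu) (hnorm (hp1 u hu))
      (hnorm (hq1 u hu)) (hpq u hu) (hmem hp hpW u hu w)
    have h0 := hdi hp hp hp1 u hu w
    have h0' : ⟪p u, fderiv ℝ p u w⟫_ℝ = 0 := by
      linarith [real_inner_comm (p u) (fderiv ℝ p u w)]
    rwa [h0', zero_smul, zero_add] at h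
  have hDq : ∀ u ∈ U, ∀ w, fderiv ℝ q u w = -(⟪q u, fderiv ℝ p u w⟫_ℝ • p u) := by
    intro u hu w
    have h := eq_add_of_orthonormal_pair hW (hpW u hu) (hqW u hu) (hnorm (hp1 u hu))
      (hnorm (hq1 u hu)) (hpq u hu) (hmem hq hqW u hu w)
    have h0 := hdi hq hq hq1 u hu w
    have h0' : ⟪q u, fderiv ℝ q u w⟫_ℝ = 0 := by
      linarith [real_inner_comm (q u) (fderiv ℝ q u w)]
    have h1 := hdi hp hq hpq u hu w
    rw [real_inner_comm (q u)] at h1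
    rwa [h0', zero_smul, add_zero, eq_neg_of_add_eq_zero_left h1, neg_smul] at h
  have hdp : ∀ w, ContDiffOn ℝ ∞ (fun x ↦ fderiv ℝ p x w) U := contDiffOn_fderiv_apply hU hp
  refine ⟨fun u w ↦ ⟪q u, fderiv ℝ p u w⟫_ℝ, hDp, hDq, fun u hu w ↦ ?_, fun u hu v w ↦ ?_⟩
  · exact ((hq.inner ℝ (hdp w)).contDiffAt (hU.mem_nhds hu)).differentiableAt (by simp)
  · have hd : ∀ w, DifferentiableAt ℝ (fun x ↦ fderiv ℝ p x w) u := fun w ↦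
      ((hdp w).contDiffAt (hU.mem_nhds hu)).differentiableAt (by simp)
    have hd' : DifferentiableAt ℝ q u :=
      (hq.contDiffAt (hU.mem_nhds hu)).differentiableAt (by simp)
    rw [fderiv_inner_apply ℝ hd' (hd w), fderiv_inner_apply ℝ hd' (hd v),
      fderiv_fderiv_apply_comm (hp.contDiffAt (hU.mem_nhds hu)) v w, hDq u hu, hDq u hu,
      hDp u hu v, hDp u hu w]
    simp only [inner_neg_left, real_inner_smul_left, real_inner_smul_right, hpq u hu]
    ring

end Calculus

section AdaptedFrame

open scoped InnerProductSpace

variable {V : Type*} [NormedAddCommGroup V] [NormedSpace ℝ V]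
variable {E : Type*} [NormedAddCommGroup E] [InnerProductSpace ℝ E]

/-- A smooth principal frame along the immersion `F : V → E`, defined on the open set `U`. -/
structure AdaptedFrameOn (F : V → E) (W : Submodule ℝ E) [W.HasOrthogonalProjection] (c₁ c₂ : ℝ)
    (e₁ e₂ : V → E) (U : Set V) : Prop where
  isOpen : IsOpen U
  contDiffOn : ContDiffOn ℝ ∞ F U
  contDiffOn₁ : ContDiffOn ℝ ∞ e₁ U
  contDiffOn₂ : ContDiffOn ℝ ∞ e₂ U
  frame : ∀ u ∈ U, IsPrincipalFrame (LinearMap.range (fderiv ℝ F u : V →ₗ[ℝ] E)) W c₁ c₂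
    (e₁ u) (e₂ u)

theorem AdaptedFrameOn.swap {F : V → E} {W : Submodule ℝ E} [W.HasOrthogonalProjection]
    {c₁ c₂ : ℝ} {e₁ e₂ : V → E} {U : Set V} (h : AdaptedFrameOn F W c₁ c₂ e₁ e₂ U) :
    AdaptedFrameOn F W c₂ c₁ e₂ e₁ U :=
  ⟨h.isOpen, h.contDiffOn, h.contDiffOn₂, h.contDiffOn₁, fun u hu ↦ (h.frame u hu).swap⟩

theorem exists_smooth_principal_vector {F : V → E} {W : Submodule ℝ E} [W.HasOrthogonalProjection]
    {c₁ c₂ : ℝ} (hc : c₁ ^ 2 ≠ c₂ ^ 2) {U : Set V} (hU : IsOpen U) (hF : ContDiffOn ℝ ∞ F U)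
    (hinj : ∀ u ∈ U, Function.Injective (fderiv ℝ F u))
    (hframe : ∀ u ∈ U, ∃ a b,
      IsPrincipalFrame (LinearMap.range (fderiv ℝ F u : V →ₗ[ℝ] E)) W c₁ c₂ a b)
    {u₀ : V} (hu₀ : u₀ ∈ U) :
    ∃ U' ⊆ U, IsOpen U' ∧ u₀ ∈ U' ∧ ∃ e : V → E, ContDiffOn ℝ ∞ e U' ∧ ∀ u ∈ U', ∃ b,
      IsPrincipalFrame (LinearMap.range (fderiv ℝ F u : V →ₗ[ℝ] E)) W c₁ c₂ (e u) b := by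
  obtain ⟨a₀, b₀, h₀⟩ := hframe u₀ hu₀
  obtain ⟨X, hX⟩ := h₀.mem₁
  obtain ⟨Y, hY⟩ := h₀.mem₂
  change fderiv ℝ F u₀ X = a₀ at hX
  change fderiv ℝ F u₀ Y = b₀ at hY
  set m : V → V → ℝ := fun w u ↦
    ⟪W.starProjection (fderiv ℝ F u w), fderiv ℝ F u Y⟫_ℝ -
      c₁ ^ 2 * ⟪fderiv ℝ F u w, fderiv ℝ F u Y⟫_ℝ with hm
  have hDF : ∀ w, ContDiffOn ℝ ∞ (fun x ↦ fderiv ℝ F x w) U := contDiffOn_fderiv_apply hU hF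
  have hms : ∀ w, ContDiffOn ℝ ∞ (m w) U := fun w ↦
    ((W.starProjection.contDiff.comp_contDiffOn (hDF w)).inner ℝ (hDF Y)).sub
      (contDiffOn_const.mul ((hDF w).inner ℝ (hDF Y)))
  have hm₀ : m Y u₀ ≠ 0 := by
    simp only [hm, hY, h₀.proj₂, h₀.inner_self₂, mul_one]
    exact sub_ne_zero.2 hc.symm
  set U' := U ∩ m Y ⁻¹' {0}ᶜ with hU'
  have hU'o : IsOpen U' := (hms Y).continuousOn.isOpen_inter_preimage hU isOpen_compl_singleton
  set e' : V → E := fun u ↦ m Y u • fderiv ℝ F u X - m X u • fderiv ℝ F u Y with he'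
  have he's : ContDiffOn ℝ ∞ e' U' :=
    (((hms Y).smul (hDF X)).sub ((hms X).smul (hDF Y))).mono inter_subset_left
  have hne : ∀ u ∈ U', e' u ≠ 0 := by
    intro u hu h0
    have h1 : fderiv ℝ F u (m Y u • X - m X u • Y) = fderiv ℝ F u 0 := by
      rw [map_sub, map_smul, map_smul, map_zero]; exact h0
    have h2 := congrArg (fun z ↦ ⟪a₀, fderiv ℝ F u₀ z⟫_ℝ) (hinj u hu.1 h1)
    simp only [map_sub, map_smul, hX, hY, inner_sub_right, real_inner_smul_right, h₀.inner_self₁,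
      h₀.ortho, map_zero, inner_zero_right] at h2
    exact hu.2 (by simpa using h2)
  refine ⟨U', inter_subset_left, hU'o, ⟨hu₀, hm₀⟩, fun u ↦ ‖e' u‖⁻¹ • e' u,
    ((he's.norm ℝ hne).inv fun u hu ↦ norm_ne_zero_iff.2 (hne u hu)).smul he's, fun u hu ↦ ?_⟩
  obtain ⟨a, b, h⟩ := hframe u hu.1
  have hmem : ∀ w, fderiv ℝ F u w ∈ LinearMap.range (fderiv ℝ F u : V →ₗ[ℝ] E) := fun w ↦ ⟨w, rfl⟩
  have hmw : ∀ w, m w u = (c₂ ^ 2 - c₁ ^ 2) * (⟪b, fderiv ℝ F u w⟫_ℝ * ⟪b, fderiv ℝ F u Y⟫_ℝ) :=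
    fun w ↦ h.inner_starProjection_sub (hmem w) (hmem Y)
  have horth : ⟪b, e' u⟫_ℝ = 0 := by
    simp only [he', inner_sub_right, real_inner_smul_right, hmw]
    ring
  refine ⟨b, ?_⟩
  rcases h.eq_or_eq_neg_of_norm_eq_one (e := ‖e' u‖⁻¹ • e' u)
    (Submodule.smul_mem _ _ (Submodule.sub_mem _ (Submodule.smul_mem _ _ (hmem X))
      (Submodule.smul_mem _ _ (hmem Y))))
    (by rw [norm_smul, norm_inv, norm_norm, inv_mul_cancel₀ (norm_ne_zero_iff.2 (hne u hu))])
    (by rw [real_inner_smul_right, horth, mul_zero]) with h' | h'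
  · beta_reduce; rw [h']; exact h
  · beta_reduce; rw [h']; exact h.neg₁

theorem exists_adaptedFrameOn {F : V → E} {W : Submodule ℝ E} [W.HasOrthogonalProjection]
    {c₁ c₂ : ℝ} (hc : c₁ ^ 2 ≠ c₂ ^ 2) {U : Set V} (hU : IsOpen U) (hF : ContDiffOn ℝ ∞ F U)
    (hinj : ∀ u ∈ U, Function.Injective (fderiv ℝ F u))
    (hframe : ∀ u ∈ U, ∃ a b,
      IsPrincipalFrame (LinearMap.range (fderiv ℝ F u : V →ₗ[ℝ] E)) W c₁ c₂ a b)
    {u₀ : V} (hu₀ : u₀ ∈ U) :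
    ∃ U' ⊆ U, u₀ ∈ U' ∧ ∃ e₁ e₂ : V → E, AdaptedFrameOn F W c₁ c₂ e₁ e₂ U' := by
  obtain ⟨U₁, hsub₁, hU₁, hu₁, e₁, he₁, h₁⟩ :=
    exists_smooth_principal_vector hc hU hF hinj hframe hu₀
  obtain ⟨U₂, hsub₂, hU₂, hu₂, e₂, he₂, h₂⟩ :=
    exists_smooth_principal_vector hc.symm hU hF hinj
      (fun u hu ↦ let ⟨a, b, h⟩ := hframe u hu; ⟨b, a, h.swap⟩) hu₀
  refine ⟨U₁ ∩ U₂, inter_subset_left.trans hsub₁, ⟨hu₁, hu₂⟩, e₁, e₂, hU₁.inter hU₂,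
    hF.mono (inter_subset_left.trans hsub₁), he₁.mono inter_subset_left,
    he₂.mono inter_subset_right, fun u hu ↦ ?_⟩
  obtain ⟨b, hb⟩ := h₁ u hu.1
  obtain ⟨a, ha⟩ := h₂ u hu.2
  exact hb.mix hc ha.swap

end AdaptedFrame

section StructureEquations

open scoped InnerProductSpace

variable {V : Type*} [NormedAddCommGroup V] [NormedSpace ℝ V]
variable {E : Type*} [NormedAddCommGroup E] [InnerProductSpace ℝ E]

/-- The Maurer–Cartan structure of an adapted frame: `β` and `γ` are the connection forms
`⟪De₁, e₄⟫` and `⟪De₂, e₃⟫`. They are closed, and determine the connection form `⟪De₁, e₂⟫` as well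
as the rate of change of the tangent plane relative to `W`. -/
structure StructureForms (W : Submodule ℝ E) [W.HasOrthogonalProjection] (c₁ s₁ c₂ s₂ : ℝ)
    (e₁ e₂ : V → E) (U : Set V) (β γ : V → V → ℝ) (e₃ e₄ : V → E) : Prop where
  differentiableAt₁ : ∀ u ∈ U, ∀ w, DifferentiableAt ℝ (fun x ↦ β x w) u
  closed₁ : ∀ u ∈ U, ∀ v w, fderiv ℝ (fun x ↦ β x w) u v = fderiv ℝ (fun x ↦ β x v) u w
  inner₄₁ : ∀ u ∈ U, ⟪e₄ u, e₁ u⟫_ℝ = 0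
  inner₄₂ : ∀ u ∈ U, ⟪e₄ u, e₂ u⟫_ℝ = 0
  inner₄₃ : ∀ u ∈ U, ⟪e₄ u, e₃ u⟫_ℝ = 0
  inner₄₄ : ∀ u ∈ U, ⟪e₄ u, e₄ u⟫_ℝ = 1
  inner₃₁ : ∀ u ∈ U, ⟪e₃ u, e₁ u⟫_ℝ = 0
  inner₃₂ : ∀ u ∈ U, ⟪e₃ u, e₂ u⟫_ℝ = 0
  inner₃₃ : ∀ u ∈ U, ⟪e₃ u, e₃ u⟫_ℝ = 1
  fderiv₁ : ∀ u ∈ U, ∀ w, fderiv ℝ e₁ u w =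
    (-((s₂ * c₂ * β u w + s₁ * c₁ * γ u w) / (c₁ ^ 2 * s₂ ^ 2 - s₁ ^ 2 * c₂ ^ 2))) • e₂ u +
      β u w • e₄ u
  fderiv₂ : ∀ u ∈ U, ∀ w, fderiv ℝ e₂ u w =
    ((s₂ * c₂ * β u w + s₁ * c₁ * γ u w) / (c₁ ^ 2 * s₂ ^ 2 - s₁ ^ 2 * c₂ ^ 2)) • e₁ u +
      γ u w • e₃ u
  norm_fderiv : ∀ u ∈ U, ∀ w, ‖fderiv ℝ (fun x ↦ W.starProjection
      (⟪e₁ x, W.starProjection (e₁ u)⟫_ℝ • e₁ x + ⟪e₂ x, W.starProjection (e₁ u)⟫_ℝ • e₂ x)) u w‖ =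
    |(c₁ ^ 2 - c₂ ^ 2) * c₁ *
      ((s₂ * c₁ * β u w + s₁ * c₂ * γ u w) / (c₁ ^ 2 * s₂ ^ 2 - s₁ ^ 2 * c₂ ^ 2))|

theorem AdaptedFrameOn.exists_structureForms {F : V → E} {W : Submodule ℝ E}
    [W.HasOrthogonalProjection] {c₁ s₁ c₂ s₂ : ℝ} {e₁ e₂ : V → E} {U : Set V}
    (h : AdaptedFrameOn F W c₁ c₂ e₁ e₂ U) (hW : Module.finrank ℝ W = 2)
    (hW' : Module.finrank ℝ Wᗮ = 2) (hc₁ : 0 < c₁) (hs₁ : 0 < s₁) (hc₂ : 0 < c₂) (hs₂ : 0 < s₂)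
    (h₁ : c₁ ^ 2 + s₁ ^ 2 = 1) (h₂ : c₂ ^ 2 + s₂ ^ 2 = 1) (hc : c₁ ^ 2 ≠ c₂ ^ 2) :
    ∃ β γ e₃ e₄, StructureForms W c₁ s₁ c₂ s₂ e₁ e₂ U β γ e₃ e₄ := by
  have hD : c₁ ^ 2 * s₂ ^ 2 - s₁ ^ 2 * c₂ ^ 2 ≠ 0 := by
    have : c₁ ^ 2 * s₂ ^ 2 - s₁ ^ 2 * c₂ ^ 2 = c₁ ^ 2 - c₂ ^ 2 := by
      rw [eq_sub_of_add_eq' h₁, eq_sub_of_add_eq' h₂]; ring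
    rw [this]; exact sub_ne_zero.2 hc
  set P := W.starProjection with hP
  have hPsm : ∀ {e : V → E}, ContDiffOn ℝ ∞ e U → ContDiffOn ℝ ∞ (fun x ↦ P (e x)) U := fun he ↦
    P.contDiff.comp_contDiffOn he
  have hPW : ∀ x, P x ∈ W := W.starProjection_apply_mem
  have hPW' : ∀ x, x - P x ∈ Wᗮ := fun x ↦ W.sub_starProjection_mem_orthogonal x
  have hPP : ∀ a b, ⟪P a, P b⟫_ℝ = ⟪P a, b⟫_ℝ := inner_starProjection_starProjection W
  have hPP' : ∀ a b, ⟪a, P b⟫_ℝ = ⟪P a, b⟫_ℝ := fun a b ↦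
    (W.inner_starProjection_left_eq_right a b).symm
  obtain ⟨p₁, hp₁⟩ : ∃ r : V → E, r = fun x ↦ c₁⁻¹ • P (e₁ x) := ⟨_, rfl⟩
  obtain ⟨p₂, hp₂⟩ : ∃ r : V → E, r = fun x ↦ c₂⁻¹ • P (e₂ x) := ⟨_, rfl⟩
  obtain ⟨n₁, hn₁⟩ : ∃ r : V → E, r = fun x ↦ s₁⁻¹ • (e₁ x - P (e₁ x)) := ⟨_, rfl⟩
  obtain ⟨n₂, hn₂⟩ : ∃ r : V → E, r = fun x ↦ s₂⁻¹ • (e₂ x - P (e₂ x)) := ⟨_, rfl⟩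
  have hp₁s : ContDiffOn ℝ ∞ p₁ U := hp₁ ▸ (hPsm h.contDiffOn₁).const_smul c₁⁻¹
  have hp₂s : ContDiffOn ℝ ∞ p₂ U := hp₂ ▸ (hPsm h.contDiffOn₂).const_smul c₂⁻¹
  have hn₁s : ContDiffOn ℝ ∞ n₁ U := hn₁ ▸ (h.contDiffOn₁.sub (hPsm h.contDiffOn₁)).const_smul s₁⁻¹
  have hn₂s : ContDiffOn ℝ ∞ n₂ U := hn₂ ▸ (h.contDiffOn₂.sub (hPsm h.contDiffOn₂)).const_smul s₂⁻¹
  have hpW₁ : ∀ u ∈ U, p₁ u ∈ W := fun u _ ↦ hp₁ ▸ W.smul_mem _ (hPW _)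
  have hnW₁ : ∀ u ∈ U, n₁ u ∈ Wᗮ := fun u _ ↦ hn₁ ▸ Wᗮ.smul_mem _ (hPW' _)
  have hpp₁ : ∀ u ∈ U, ⟪p₁ u, p₁ u⟫_ℝ = 1 := fun u hu ↦ by
    simp only [hp₁, real_inner_smul_left, real_inner_smul_right, hPP, (h.frame u hu).proj₁, P]
    field_simp
  have hpW₂ : ∀ u ∈ U, p₂ u ∈ W := fun u _ ↦ hp₂ ▸ W.smul_mem _ (hPW _)
  have hnW₂ : ∀ u ∈ U, n₂ u ∈ Wᗮ := fun u _ ↦ hn₂ ▸ Wᗮ.smul_mem _ (hPW' _)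
  have hpp₂ : ∀ u ∈ U, ⟪p₂ u, p₂ u⟫_ℝ = 1 := fun u hu ↦ by
    simp only [hp₂, real_inner_smul_left, real_inner_smul_right, hPP, (h.frame u hu).proj₂, P]
    field_simp
  have hpp₁₂ : ∀ u ∈ U, ⟪p₁ u, p₂ u⟫_ℝ = 0 := fun u hu ↦ by
    simp only [hp₁, hp₂, real_inner_smul_left, real_inner_smul_right, hPP, (h.frame u hu).proj₁₂,
      P, mul_zero]
  have hnn : ∀ a b : E, ⟪a - P a, b - P b⟫_ℝ = ⟪a, b⟫_ℝ - ⟪P a, b⟫_ℝ := fun a b ↦ by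
    rw [inner_sub_left, inner_sub_right, inner_sub_right, hPP, hPP']
    ring
  have hnn₁ : ∀ u ∈ U, ⟪n₁ u, n₁ u⟫_ℝ = 1 := fun u hu ↦ by
    simp only [hn₁, real_inner_smul_left, real_inner_smul_right, hnn, (h.frame u hu).proj₁,
      (h.frame u hu).inner_self₁, P, ← eq_sub_of_add_eq' h₁]
    field_simp
  have hnn₂ : ∀ u ∈ U, ⟪n₂ u, n₂ u⟫_ℝ = 1 := fun u hu ↦ by
    simp only [hn₂, real_inner_smul_left, real_inner_smul_right, hnn, (h.frame u hu).proj₂,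
      (h.frame u hu).inner_self₂, P, ← eq_sub_of_add_eq' h₂]
    field_simp
  have hnn₁₂ : ∀ u ∈ U, ⟪n₁ u, n₂ u⟫_ℝ = 0 := fun u hu ↦ by
    simp only [hn₁, hn₂, real_inner_smul_left, real_inner_smul_right, hnn, (h.frame u hu).proj₁₂,
      (h.frame u hu).ortho, P, sub_zero, mul_zero]
  have hpn : ∀ a b : E, ⟪P a, b - P b⟫_ℝ = 0 := fun a b ↦ by
    rw [inner_sub_right, hPP, sub_self]
  have hpn₁₁ : ∀ u, ⟪p₁ u, n₁ u⟫_ℝ = 0 := fun u ↦ by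
    simp only [hp₁, hn₁, real_inner_smul_left, real_inner_smul_right, hpn, mul_zero]
  have hpn₁₂ : ∀ u, ⟪p₁ u, n₂ u⟫_ℝ = 0 := fun u ↦ by
    simp only [hp₁, hn₂, real_inner_smul_left, real_inner_smul_right, hpn, mul_zero]
  have hpn₂₁ : ∀ u, ⟪p₂ u, n₁ u⟫_ℝ = 0 := fun u ↦ by
    simp only [hp₂, hn₁, real_inner_smul_left, real_inner_smul_right, hpn, mul_zero]
  have hpn₂₂ : ∀ u, ⟪p₂ u, n₂ u⟫_ℝ = 0 := fun u ↦ by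
    simp only [hp₂, hn₂, real_inner_smul_left, real_inner_smul_right, hpn, mul_zero]
  have he₁ : ∀ x, e₁ x = c₁ • p₁ x + s₁ • n₁ x := fun x ↦ by
    simp only [hp₁, hn₁, smul_smul, mul_inv_cancel₀ hc₁.ne', mul_inv_cancel₀ hs₁.ne', one_smul,
      add_sub_cancel]
  have he₂ : ∀ x, e₂ x = c₂ • p₂ x + s₂ • n₂ x := fun x ↦ by
    simp only [hp₂, hn₂, smul_smul, mul_inv_cancel₀ hc₂.ne', mul_inv_cancel₀ hs₂.ne', one_smul,
      add_sub_cancel]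
  have hPe₁ : ∀ x, P (e₁ x) = c₁ • p₁ x := fun x ↦ by
    simp only [hp₁, smul_smul, mul_inv_cancel₀ hc₁.ne', one_smul]
  have hPe₂ : ∀ x, P (e₂ x) = c₂ • p₂ x := fun x ↦ by
    simp only [hp₂, smul_smul, mul_inv_cancel₀ hc₂.ne', one_smul]
  obtain ⟨θ, hθ₁, hθ₂, hθd, hθs⟩ := exists_rotation_form hW h.isOpen hp₁s hp₂s
    hpW₁ hpW₂ hpp₁ hpp₂ hpp₁₂
  obtain ⟨τ, hτ₁, hτ₂, hτd, hτs⟩ := exists_rotation_form hW' h.isOpen hn₁s hn₂s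
    hnW₁ hnW₂ hnn₁ hnn₂ hnn₁₂
  have hdiff : ∀ {e : V → E}, ContDiffOn ℝ ∞ e U → ∀ u ∈ U, DifferentiableAt ℝ e u :=
    fun he u hu ↦ (he.contDiffAt (h.isOpen.mem_nhds hu)).differentiableAt (by simp)
  have hDe₁ : ∀ u ∈ U, ∀ w, fderiv ℝ e₁ u w = c₁ • θ u w • p₂ u + s₁ • τ u w • n₂ u := by
    intro u hu w
    have hd : fderiv ℝ e₁ u = c₁ • fderiv ℝ p₁ u + s₁ • fderiv ℝ n₁ u := by
      rw [funext he₁]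
      exact (((hdiff hp₁s u hu).hasFDerivAt.const_smul c₁).add
        ((hdiff hn₁s u hu).hasFDerivAt.const_smul s₁)).fderiv
    rw [hd]
    simp only [add_apply, smul_apply, hθ₁ u hu, hτ₁ u hu]
  have hDe₂ : ∀ u ∈ U, ∀ w, fderiv ℝ e₂ u w = c₂ • -(θ u w • p₁ u) + s₂ • -(τ u w • n₁ u) := by
    intro u hu w
    have hd : fderiv ℝ e₂ u = c₂ • fderiv ℝ p₂ u + s₂ • fderiv ℝ n₂ u := by
      rw [funext he₂]
      exact (((hdiff hp₂s u hu).hasFDerivAt.const_smul c₂).add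
        ((hdiff hn₂s u hu).hasFDerivAt.const_smul s₂)).fderiv
    rw [hd]
    simp only [add_apply, smul_apply, hθ₂ u hu, hτ₂ u hu]
  have hsym : ∀ {a b : V → E}, (∀ u, ⟪a u, b u⟫_ℝ = 0) → ∀ u, ⟪b u, a u⟫_ℝ = 0 := fun hab u ↦ by
    rw [real_inner_comm]; exact hab u
  have hpp₂₁ : ∀ u ∈ U, ⟪p₂ u, p₁ u⟫_ℝ = 0 := fun u hu ↦ by
    rw [real_inner_comm]; exact hpp₁₂ u hu
  have hnn₂₁ : ∀ u ∈ U, ⟪n₂ u, n₁ u⟫_ℝ = 0 := fun u hu ↦ by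
    rw [real_inner_comm]; exact hnn₁₂ u hu
  have hω : ∀ u w, (s₂ * c₂ * (-(c₁ * s₂) * θ u w + s₁ * c₂ * τ u w) +
      s₁ * c₁ * (c₂ * s₁ * θ u w - s₂ * c₁ * τ u w)) / (c₁ ^ 2 * s₂ ^ 2 - s₁ ^ 2 * c₂ ^ 2) =
      -(c₁ * c₂ * θ u w + s₁ * s₂ * τ u w) := by
    intro u w
    rw [div_eq_iff hD]
    linear_combination (θ u w * c₁ * c₂ * s₂ ^ 2 - τ u w * s₁ * s₂ * c₂ ^ 2) * h₁ +
      (-(θ u w * c₁ * c₂ * s₁ ^ 2) + τ u w * s₁ * s₂ * c₁ ^ 2) * h₂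
  refine ⟨fun u w ↦ -(c₁ * s₂) * θ u w + s₁ * c₂ * τ u w,
    fun u w ↦ c₂ * s₁ * θ u w - s₂ * c₁ * τ u w,
    fun u ↦ -s₁ • p₁ u + c₁ • n₁ u, fun u ↦ -s₂ • p₂ u + c₂ • n₂ u,
    ?_, ?_, ?_, ?_, ?_, ?_, ?_, ?_, ?_, ?_, ?_, ?_⟩
  · exact fun u hu w ↦ ((hθd u hu w).const_mul _).add ((hτd u hu w).const_mul _)
  · intro u hu v w
    have hf : ∀ w, fderiv ℝ (fun x ↦ -(c₁ * s₂) * θ x w + s₁ * c₂ * τ x w) u =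
        -(c₁ * s₂) • fderiv ℝ (fun x ↦ θ x w) u + (s₁ * c₂) • fderiv ℝ (fun x ↦ τ x w) u := by
      intro w
      rw [fderiv_fun_add ((hθd u hu w).const_mul _) ((hτd u hu w).const_mul _),
        fderiv_const_mul (hθd u hu w), fderiv_const_mul (hτd u hu w)]
    rw [hf, hf, add_apply, add_apply,
      smul_apply, smul_apply,
      smul_apply, smul_apply, hθs u hu v w, hτs u hu v w]
  iterate 7
    · intro u hu
      simp only [he₁, he₂, inner_add_left, inner_add_right, real_inner_smul_left,
        real_inner_smul_right, hpp₁ u hu, hpp₂ u hu, hnn₁ u hu, hnn₂ u hu, hpp₁₂ u hu, hpp₂₁ u hu,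
        hnn₁₂ u hu, hnn₂₁ u hu, hpn₁₁, hpn₁₂, hpn₂₁, hpn₂₂, hsym hpn₁₁, hsym hpn₁₂, hsym hpn₂₁,
        hsym hpn₂₂]
      first | ring1 | linear_combination h₁ | linear_combination h₂
  · intro u hu w
    rw [hDe₁ u hu w, he₂]
    simp only [smul_add, smul_smul]
    rw [hω, neg_neg]
    have : ∀ a b a' b' c' d' : ℝ, a' + c' = a → b' + d' = b → a • p₂ u + b • n₂ u =
        a' • p₂ u + b' • n₂ u + (c' • p₂ u + d' • n₂ u) := by
      rintro a b a' b' c' d' rfl rfl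
      module
    refine this _ _ _ _ _ _ ?_ ?_
    · linear_combination (c₁ * θ u w) * h₂
    · linear_combination (s₁ * τ u w) * h₂
  · intro u hu w
    rw [hDe₂ u hu w, he₁]
    rw [hω]
    simp only [smul_add, smul_smul, ← neg_smul]
    have : ∀ a b a' b' c' d' : ℝ, a' + c' = a → b' + d' = b → a • p₁ u + b • n₁ u =
        a' • p₁ u + b' • n₁ u + (c' • p₁ u + d' • n₁ u) := by
      rintro a b a' b' c' d' rfl rfl
      module
    refine this _ _ _ _ _ _ ?_ ?_
    · linear_combination (-c₂ * θ u w) * h₁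
    · linear_combination (-s₂ * τ u w) * h₁
  · intro u hu w
    have hfun : (fun x ↦ P (⟪e₁ x, P (e₁ u)⟫_ℝ • e₁ x + ⟪e₂ x, P (e₁ u)⟫_ℝ • e₂ x)) =
        fun x ↦ (c₁ ^ 2 * ⟪p₁ x, e₁ u⟫_ℝ) • p₁ x + (c₂ ^ 2 * ⟪p₂ x, e₁ u⟫_ℝ) • p₂ x := by
      funext x
      rw [map_add, map_smul, map_smul, hPP', hPP', hPe₁, hPe₂, real_inner_smul_left,
        real_inner_smul_left, smul_smul, smul_smul]
      congr 2 <;> ring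
    have hip : ∀ {p : V → E}, ContDiffOn ℝ ∞ p U → ∀ c : ℝ,
        fderiv ℝ (fun x ↦ (c * ⟪p x, e₁ u⟫_ℝ) • p x) u w =
          (c * ⟪p u, e₁ u⟫_ℝ) • fderiv ℝ p u w + (c * ⟪fderiv ℝ p u w, e₁ u⟫_ℝ) • p u := by
      intro p hp c
      have hpd := hdiff hp u hu
      have hi : DifferentiableAt ℝ (fun x ↦ ⟪p x, e₁ u⟫_ℝ) u :=
        hpd.inner ℝ (differentiableAt_const _)
      rw [fderiv_fun_smul (hi.const_mul c) hpd, fderiv_const_mul hi]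
      simp only [add_apply, smul_apply,
        ContinuousLinearMap.smulRight_apply]
      rw [fderiv_inner_apply ℝ hpd (differentiableAt_const _)]
      simp
    have hid : ∀ {p : V → E}, ContDiffOn ℝ ∞ p U → ∀ c : ℝ,
        DifferentiableAt ℝ (fun x ↦ (c * ⟪p x, e₁ u⟫_ℝ) • p x) u := fun hp c ↦
      (((hdiff hp u hu).inner ℝ (differentiableAt_const _)).const_mul c).smul (hdiff hp u hu)
    have hpe₁ : ⟪p₁ u, e₁ u⟫_ℝ = c₁ := by
      rw [he₁, inner_add_right, real_inner_smul_right, real_inner_smul_right, hpp₁ u hu, hpn₁₁]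
      ring
    have hpe₂ : ⟪p₂ u, e₁ u⟫_ℝ = 0 := by
      rw [he₁, inner_add_right, real_inner_smul_right, real_inner_smul_right, hpp₂₁ u hu, hpn₂₁]
      ring
    rw [hfun, fderiv_fun_add (hid hp₁s _) (hid hp₂s _), add_apply, hip hp₁s,
      hip hp₂s, hθ₁ u hu, hθ₂ u hu, inner_neg_left, real_inner_smul_left, real_inner_smul_left,
      hpe₁, hpe₂]
    have hθ : (s₂ * c₁ * (-(c₁ * s₂) * θ u w + s₁ * c₂ * τ u w) +
        s₁ * c₂ * (c₂ * s₁ * θ u w - s₂ * c₁ * τ u w)) / (c₁ ^ 2 * s₂ ^ 2 - s₁ ^ 2 * c₂ ^ 2) =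
        -θ u w := by
      rw [div_eq_iff hD]
      ring
    rw [hθ]
    have hn : ‖p₂ u‖ = 1 := by
      have := hpp₂ u hu
      rw [real_inner_self_eq_norm_sq] at this
      nlinarith [norm_nonneg (p₂ u)]
    have : (c₁ ^ 2 * c₁) • θ u w • p₂ u + (c₁ ^ 2 * (θ u w * 0)) • p₁ u +
        ((c₂ ^ 2 * 0) • -(θ u w • p₁ u) + (c₂ ^ 2 * -(θ u w * c₁)) • p₂ u) =
        (-((c₁ ^ 2 - c₂ ^ 2) * c₁ * -θ u w)) • p₂ u := by
      module
    rw [this, norm_smul, hn, mul_one, Real.norm_eq_abs, abs_neg]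

end StructureEquations

section Riccati

open scoped InnerProductSpace

variable {V : Type*} [NormedAddCommGroup V] [NormedSpace ℝ V]
variable {E : Type*} [NormedAddCommGroup E] [InnerProductSpace ℝ E]

variable {F : V → E} {W : Submodule ℝ E} [W.HasOrthogonalProjection] {c₁ s₁ c₂ s₂ : ℝ}
  {e₁ e₂ : V → E} {U : Set V}

/-- The rotation speed in the direction `v` of the projection to `W` of the plane spanned by
`e₁, e₂`. -/
noncomputable def rotationSpeed (W : Submodule ℝ E) [W.HasOrthogonalProjection] (e₁ e₂ : V → E)
    (u v : V) : ℝ :=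
  ‖fderiv ℝ (fun x ↦ W.starProjection
      (⟪e₁ x, W.starProjection (e₁ u)⟫_ℝ • e₁ x + ⟪e₂ x, W.starProjection (e₁ u)⟫_ℝ • e₂ x)) u v‖

namespace AdaptedFrameOn

theorem fderiv_eq (h : AdaptedFrameOn F W c₁ c₂ e₁ e₂ U) {u : V} (hu : u ∈ U) (w : V) :
    fderiv ℝ F u w = ⟪e₁ u, fderiv ℝ F u w⟫_ℝ • e₁ u + ⟪e₂ u, fderiv ℝ F u w⟫_ℝ • e₂ u :=
  (h.frame u hu).repr _ ⟨w, rfl⟩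

theorem differentiableAt_of_contDiffOn (h : AdaptedFrameOn F W c₁ c₂ e₁ e₂ U) {G : Type*}
    [NormedAddCommGroup G] [NormedSpace ℝ G] {f : V → G} (hf : ContDiffOn ℝ ∞ f U) {u : V}
    (hu : u ∈ U) : DifferentiableAt ℝ f u :=
  (hf.contDiffAt (h.isOpen.mem_nhds hu)).differentiableAt (by simp)

theorem contDiffOn_coframe (h : AdaptedFrameOn F W c₁ c₂ e₁ e₂ U) (w : V) :
    ContDiffOn ℝ ∞ (fun x ↦ ⟪e₁ x, fderiv ℝ F x w⟫_ℝ) U :=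
  h.contDiffOn₁.inner ℝ (contDiffOn_fderiv_apply h.isOpen h.contDiffOn w)

theorem fderiv_fderiv_eq (h : AdaptedFrameOn F W c₁ c₂ e₁ e₂ U) {u : V} (hu : u ∈ U) (v w : V) :
    fderiv ℝ (fun x ↦ fderiv ℝ F x w) u v =
      (⟪e₁ u, fderiv ℝ F u w⟫_ℝ • fderiv ℝ e₁ u v +
        fderiv ℝ (fun x ↦ ⟪e₁ x, fderiv ℝ F x w⟫_ℝ) u v • e₁ u) +
      (⟪e₂ u, fderiv ℝ F u w⟫_ℝ • fderiv ℝ e₂ u v +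
        fderiv ℝ (fun x ↦ ⟪e₂ x, fderiv ℝ F x w⟫_ℝ) u v • e₂ u) := by
  have heq : (fun x ↦ fderiv ℝ F x w) =ᶠ[𝓝 u] fun x ↦
      ⟪e₁ x, fderiv ℝ F x w⟫_ℝ • e₁ x + ⟪e₂ x, fderiv ℝ F x w⟫_ℝ • e₂ x := by
    filter_upwards [h.isOpen.mem_nhds hu] with x hx using h.fderiv_eq hx w
  have h1 := (h.differentiableAt_of_contDiffOn (h.contDiffOn_coframe w) hu).hasFDerivAt.smul
    (h.differentiableAt_of_contDiffOn h.contDiffOn₁ hu).hasFDerivAt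
  have h2 := (h.differentiableAt_of_contDiffOn (h.swap.contDiffOn_coframe w) hu).hasFDerivAt.smul
    (h.differentiableAt_of_contDiffOn h.contDiffOn₂ hu).hasFDerivAt
  rw [((h1.add h2).congr_of_eventuallyEq heq).fderiv]
  rfl

variable {β γ : V → V → ℝ} {e₃ e₄ : V → E}

theorem inner_fderiv_fderiv_comm (h : AdaptedFrameOn F W c₁ c₂ e₁ e₂ U) {u : V} (hu : u ∈ U)
    (z : E) (v w : V) : ⟪z, fderiv ℝ (fun x ↦ fderiv ℝ F x w) u v⟫_ℝ =
      ⟪z, fderiv ℝ (fun x ↦ fderiv ℝ F x v) u w⟫_ℝ := by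
  rw [fderiv_fderiv_apply_comm (h.contDiffOn.contDiffAt (h.isOpen.mem_nhds hu))]

/-- Cartan's lemma for `β`. -/
theorem coframe_mul_comm₁ (h : AdaptedFrameOn F W c₁ c₂ e₁ e₂ U)
    (S : StructureForms W c₁ s₁ c₂ s₂ e₁ e₂ U β γ e₃ e₄) {u : V} (hu : u ∈ U) (v w : V) :
    ⟪e₁ u, fderiv ℝ F u w⟫_ℝ * β u v = ⟪e₁ u, fderiv ℝ F u v⟫_ℝ * β u w := by
  have := h.inner_fderiv_fderiv_comm hu (e₄ u) v w
  simpa only [h.fderiv_fderiv_eq hu, inner_add_right, real_inner_smul_right, S.inner₄₁ u hu,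
    S.inner₄₂ u hu, S.inner₄₃ u hu, S.inner₄₄ u hu, S.fderiv₁ u hu, S.fderiv₂ u hu, mul_zero,
    add_zero, zero_add, mul_one] using this

/-- Cartan's lemma for `γ`. -/
theorem coframe_mul_comm₂ (h : AdaptedFrameOn F W c₁ c₂ e₁ e₂ U)
    (S : StructureForms W c₁ s₁ c₂ s₂ e₁ e₂ U β γ e₃ e₄) {u : V} (hu : u ∈ U) (v w : V) :
    ⟪e₂ u, fderiv ℝ F u w⟫_ℝ * γ u v = ⟪e₂ u, fderiv ℝ F u v⟫_ℝ * γ u w := by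
  have := h.inner_fderiv_fderiv_comm hu (e₃ u) v w
  have h34 : ⟪e₃ u, e₄ u⟫_ℝ = 0 := by rw [real_inner_comm]; exact S.inner₄₃ u hu
  simpa only [h.fderiv_fderiv_eq hu, inner_add_right, real_inner_smul_right, S.inner₃₁ u hu,
    S.inner₃₂ u hu, h34, S.inner₃₃ u hu, S.fderiv₁ u hu, S.fderiv₂ u hu, mul_zero,
    add_zero, zero_add, mul_one] using this

/-- The first structure equation for the form dual to `e₁`. -/
theorem fderiv_coframe_sub (h : AdaptedFrameOn F W c₁ c₂ e₁ e₂ U)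
    (S : StructureForms W c₁ s₁ c₂ s₂ e₁ e₂ U β γ e₃ e₄) {u : V} (hu : u ∈ U) (v w : V) :
    ⟪e₂ u, fderiv ℝ F u w⟫_ℝ * ((s₂ * c₂ * β u v + s₁ * c₁ * γ u v) /
        (c₁ ^ 2 * s₂ ^ 2 - s₁ ^ 2 * c₂ ^ 2)) +
      fderiv ℝ (fun x ↦ ⟪e₁ x, fderiv ℝ F x w⟫_ℝ) u v =
    ⟪e₂ u, fderiv ℝ F u v⟫_ℝ * ((s₂ * c₂ * β u w + s₁ * c₁ * γ u w) /
        (c₁ ^ 2 * s₂ ^ 2 - s₁ ^ 2 * c₂ ^ 2)) +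
      fderiv ℝ (fun x ↦ ⟪e₁ x, fderiv ℝ F x v⟫_ℝ) u w := by
  have := h.inner_fderiv_fderiv_comm hu (e₁ u) v w
  have h13 : ⟪e₁ u, e₃ u⟫_ℝ = 0 := by rw [real_inner_comm]; exact S.inner₃₁ u hu
  have h14 : ⟪e₁ u, e₄ u⟫_ℝ = 0 := by rw [real_inner_comm]; exact S.inner₄₁ u hu
  simp only [h.fderiv_fderiv_eq hu, inner_add_right, real_inner_smul_right, h13, h14,
    (h.frame u hu).ortho, (h.frame u hu).inner_self₁, S.fderiv₁ u hu, S.fderiv₂ u hu, mul_zero,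
    add_zero, zero_add, mul_one] at this
  linarith

theorem coframe_apply (h : AdaptedFrameOn F W c₁ c₂ e₁ e₂ U) {u : V} (hu : u ∈ U) {X : V}
    (hX : fderiv ℝ F u X = e₁ u) :
    ⟪e₁ u, fderiv ℝ F u X⟫_ℝ = 1 ∧ ⟪e₂ u, fderiv ℝ F u X⟫_ℝ = 0 := by
  rw [hX]; exact ⟨(h.frame u hu).inner_self₁, (h.frame u hu).ortho'⟩

theorem γ_eq_zero (h : AdaptedFrameOn F W c₁ c₂ e₁ e₂ U)
    (S : StructureForms W c₁ s₁ c₂ s₂ e₁ e₂ U β γ e₃ e₄) {u : V} (hu : u ∈ U) {X : V}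
    (hX : fderiv ℝ F u X = e₁ u) : γ u X = 0 := by
  obtain ⟨Y, hY⟩ := (h.frame u hu).mem₂
  have := h.coframe_mul_comm₂ S hu X Y
  rwa [(h.coframe_apply hu hX).2, (h.swap.coframe_apply hu hY).1, one_mul, zero_mul] at this

theorem rotationSpeed_eq (h : AdaptedFrameOn F W c₁ c₂ e₁ e₂ U)
    (S : StructureForms W c₁ s₁ c₂ s₂ e₁ e₂ U β γ e₃ e₄) (hs₂ : 0 < s₂)
    (h₁ : c₁ ^ 2 + s₁ ^ 2 = 1) (h₂ : c₂ ^ 2 + s₂ ^ 2 = 1) (hc : c₁ ^ 2 ≠ c₂ ^ 2) {u : V}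
    (hu : u ∈ U) {X : V} (hX : fderiv ℝ F u X = e₁ u) :
    rotationSpeed W e₁ e₂ u X = c₁ ^ 2 * s₂ * |β u X| := by
  have hD : c₁ ^ 2 * s₂ ^ 2 - s₁ ^ 2 * c₂ ^ 2 = c₁ ^ 2 - c₂ ^ 2 := by
    linear_combination c₁ ^ 2 * h₂ - c₂ ^ 2 * h₁
  rw [rotationSpeed, S.norm_fderiv u hu, h.γ_eq_zero S hu hX, hD]
  have : (c₁ ^ 2 - c₂ ^ 2) * c₁ * ((s₂ * c₁ * β u X + s₁ * c₂ * 0) / (c₁ ^ 2 - c₂ ^ 2)) =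
      c₁ ^ 2 * s₂ * β u X := by
    have := sub_ne_zero.2 hc
    field_simp
    ring
  rw [this, abs_mul, abs_of_nonneg (by positivity)]

/-- The Riccati equation: in a principal frame, the coefficient `a` of the second fundamental form,
proportional to the rotation speed along `e₁`, satisfies `e₂(a) = A a ^ 2`. -/
theorem exists_riccati (h : AdaptedFrameOn F W c₁ c₂ e₁ e₂ U) (hW : Module.finrank ℝ W = 2)
    (hW' : Module.finrank ℝ Wᗮ = 2) (hc₁ : 0 < c₁) (hs₁ : 0 < s₁) (hc₂ : 0 < c₂) (hs₂ : 0 < s₂)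
    (h₁ : c₁ ^ 2 + s₁ ^ 2 = 1) (h₂ : c₂ ^ 2 + s₂ ^ 2 = 1) (hc : c₁ ^ 2 ≠ c₂ ^ 2) {u₀ : V}
    (hu₀ : u₀ ∈ U) :
    ∃ a : V → ℝ, DifferentiableAt ℝ a u₀ ∧
      (∀ Y, fderiv ℝ F u₀ Y = e₂ u₀ →
        fderiv ℝ a u₀ Y = -(s₂ * c₂ / (c₁ ^ 2 - c₂ ^ 2)) * a u₀ ^ 2) ∧
      ∀ᶠ u in 𝓝 u₀, ∀ v, fderiv ℝ F u v = e₁ u →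
        rotationSpeed W e₁ e₂ u v = c₁ ^ 2 * s₂ * |a u| := by
  obtain ⟨β, γ, e₃, e₄, S⟩ := h.exists_structureForms hW hW' hc₁ hs₁ hc₂ hs₂ h₁ h₂ hc
  obtain ⟨X, hX⟩ := (h.frame u₀ hu₀).mem₁
  change fderiv ℝ F u₀ X = e₁ u₀ at hX
  have hωd : ∀ w, DifferentiableAt ℝ (fun x ↦ ⟪e₁ x, fderiv ℝ F x w⟫_ℝ) u₀ := fun w ↦
    h.differentiableAt_of_contDiffOn (h.contDiffOn_coframe w) hu₀
  have hβd := S.differentiableAt₁ u₀ hu₀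
  have hX1 := h.coframe_apply hu₀ hX
  have hD : c₁ ^ 2 * s₂ ^ 2 - s₁ ^ 2 * c₂ ^ 2 = c₁ ^ 2 - c₂ ^ 2 := by
    linear_combination c₁ ^ 2 * h₂ - c₂ ^ 2 * h₁
  have hω0 : ⟪e₁ u₀, fderiv ℝ F u₀ X⟫_ℝ ≠ 0 := by rw [hX1.1]; exact one_ne_zero
  have had : DifferentiableAt ℝ (fun x ↦ β x X / ⟪e₁ x, fderiv ℝ F x X⟫_ℝ) u₀ := by
    simpa only [div_eq_mul_inv] using (hβd X).fun_mul ((hωd X).fun_inv hω0)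
  refine ⟨fun x ↦ β x X / ⟪e₁ x, fderiv ℝ F x X⟫_ℝ, had, fun Y hY ↦ ?_, ?_⟩
  · have hY1 := h.swap.coframe_apply hu₀ hY
    have hβY : β u₀ Y = 0 := by
      have := h.coframe_mul_comm₁ S hu₀ Y X
      rwa [hX1.1, hY1.2, one_mul, zero_mul] at this
    have hdiff : fderiv ℝ (fun x ↦ β x Y) u₀ X =
        β u₀ X * fderiv ℝ (fun x ↦ ⟪e₁ x, fderiv ℝ F x Y⟫_ℝ) u₀ X := by
      have heq : (fun x ↦ ⟪e₁ x, fderiv ℝ F x X⟫_ℝ * β x Y) =ᶠ[𝓝 u₀]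
          fun x ↦ ⟪e₁ x, fderiv ℝ F x Y⟫_ℝ * β x X := by
        filter_upwards [h.isOpen.mem_nhds hu₀] with x hx using h.coframe_mul_comm₁ S hx Y X
      have := congrArg (fun L : V →L[ℝ] ℝ ↦ L X) heq.fderiv_eq
      rw [fderiv_fun_mul (hωd X) (hβd Y), fderiv_fun_mul (hωd Y) (hβd X)] at this
      simpa only [add_apply, smul_apply, smul_eq_mul, hX1.1, hY1.2, hβY, zero_mul, one_mul,
        add_zero, zero_add] using this
    have hstr := h.fderiv_coframe_sub S hu₀ X Y
    rw [hY1.1, hX1.2, h.γ_eq_zero S hu₀ hX, hD] at hstr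
    have hquot : fderiv ℝ (fun x ↦ β x X / ⟪e₁ x, fderiv ℝ F x X⟫_ℝ) u₀ Y =
        fderiv ℝ (fun x ↦ β x X) u₀ Y -
          β u₀ X * fderiv ℝ (fun x ↦ ⟪e₁ x, fderiv ℝ F x X⟫_ℝ) u₀ Y := by
      have heq : (fun x ↦ β x X / ⟪e₁ x, fderiv ℝ F x X⟫_ℝ * ⟪e₁ x, fderiv ℝ F x X⟫_ℝ) =ᶠ[𝓝 u₀]
          fun x ↦ β x X := by
        filter_upwards [(hωd X).continuousAt.eventually_ne hω0] with x hx
          using div_mul_cancel₀ _ hx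
      have := congrArg (fun L : V →L[ℝ] ℝ ↦ L Y) heq.fderiv_eq
      rw [fderiv_fun_mul had (hωd X)] at this
      simp only [add_apply, smul_apply, smul_eq_mul, hX1.1, div_one, one_mul] at this
      linarith
    simp only [hquot, hX1.1, div_one, S.closed₁ u₀ hu₀ Y X, hdiff]
    linear_combination β u₀ X * hstr
  · filter_upwards [h.isOpen.mem_nhds hu₀, (hωd X).continuousAt.eventually_ne hω0]
      with u hu hne v hv
    rw [h.rotationSpeed_eq S hs₂ h₁ h₂ hc hu hv]
    have := h.coframe_mul_comm₁ S hu v X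
    rw [(h.coframe_apply hu hv).1, one_mul] at this
    rw [← this, mul_div_cancel_left₀ _ hne]

theorem fderiv_mem (h : AdaptedFrameOn F W c₁ c₂ e₁ e₂ U) (hW : Module.finrank ℝ W = 2)
    (hW' : Module.finrank ℝ Wᗮ = 2) (hc₁ : 0 < c₁) (hs₁ : 0 < s₁) (hc₂ : 0 < c₂) (hs₂ : 0 < s₂)
    (h₁ : c₁ ^ 2 + s₁ ^ 2 = 1) (h₂ : c₂ ^ 2 + s₂ ^ 2 = 1) (hc : c₁ ^ 2 ≠ c₂ ^ 2) {u : V}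
    (hu : u ∈ U) (h0 : ∀ v, fderiv ℝ F u v = e₁ u → rotationSpeed W e₁ e₂ u v = 0) (w : V) :
    fderiv ℝ e₁ u w ∈ LinearMap.range (fderiv ℝ F u : V →ₗ[ℝ] E) := by
  obtain ⟨β, γ, e₃, e₄, S⟩ := h.exists_structureForms hW hW' hc₁ hs₁ hc₂ hs₂ h₁ h₂ hc
  obtain ⟨X, hX⟩ := (h.frame u hu).mem₁
  have hβ : β u X = 0 := by
    have := h0 X hX
    rw [h.rotationSpeed_eq S hs₂ h₁ h₂ hc hu hX] at this
    simpa [hc₁.ne', hs₂.ne'] using this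
  have hβw : β u w = 0 := by
    have := h.coframe_mul_comm₁ S hu w X
    rwa [(h.coframe_apply hu hX).1, one_mul, hβ, mul_zero] at this
  rw [S.fderiv₁ u hu, hβw, zero_smul, add_zero]
  exact Submodule.smul_mem _ _ (h.frame u hu).mem₂

theorem fderiv_fderiv_mem (h : AdaptedFrameOn F W c₁ c₂ e₁ e₂ U) (hW : Module.finrank ℝ W = 2)
    (hW' : Module.finrank ℝ Wᗮ = 2) (hc₁ : 0 < c₁) (hs₁ : 0 < s₁) (hc₂ : 0 < c₂) (hs₂ : 0 < s₂)
    (h₁ : c₁ ^ 2 + s₁ ^ 2 = 1) (h₂ : c₂ ^ 2 + s₂ ^ 2 = 1) (hc : c₁ ^ 2 ≠ c₂ ^ 2) {u : V}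
    (hu : u ∈ U) (h01 : ∀ v, fderiv ℝ F u v = e₁ u → rotationSpeed W e₁ e₂ u v = 0)
    (h02 : ∀ v, fderiv ℝ F u v = e₂ u → rotationSpeed W e₂ e₁ u v = 0) (v w : V) :
    fderiv ℝ (fderiv ℝ F) u v w ∈ LinearMap.range (fderiv ℝ F u : V →ₗ[ℝ] E) := by
  rw [← fderiv_fderiv_apply (h.contDiffOn.contDiffAt (h.isOpen.mem_nhds hu)),
    h.fderiv_fderiv_eq hu]
  exact add_mem (add_mem (Submodule.smul_mem _ _
      (h.fderiv_mem hW hW' hc₁ hs₁ hc₂ hs₂ h₁ h₂ hc hu h01 v))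
      (Submodule.smul_mem _ _ (h.frame u hu).mem₁))
    (add_mem (Submodule.smul_mem _ _
      (h.swap.fderiv_mem hW hW' hc₂ hs₂ hc₁ hs₁ h₂ h₁ hc.symm hu h02 v))
      (Submodule.smul_mem _ _ (h.frame u hu).mem₂))

end AdaptedFrameOn

end Riccati

section Chart

open scoped InnerProductSpace

variable {M : Type*} [TopologicalSpace M] [ChartedSpace (EuclideanSpace ℝ (Fin 2)) M]

/-- The derivative of the inverse of the preferred chart at `x`. -/
noncomputable def chartSymmDeriv (x : M) (u : EuclideanSpace ℝ (Fin 2)) :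
    EuclideanSpace ℝ (Fin 2) →L[ℝ] EuclideanSpace ℝ (Fin 2) :=
  mfderiv (𝓡 2) (𝓡 2) (extChartAt (𝓡 2) x).symm u

variable [IsManifold (𝓡 2) ∞ M]

theorem isInvertible_chartSymmDeriv (x : M) {u : EuclideanSpace ℝ (Fin 2)}
    (hu : u ∈ (extChartAt (𝓡 2) x).target) : (chartSymmDeriv x u).IsInvertible := by
  have : IsManifold (𝓡 2) 1 M := IsManifold.of_le (n := ∞) (by simp)
  have h := isInvertible_mfderivWithin_extChartAt_symm (I := 𝓡 2) hu
  rw [(𝓡 2).range_eq_univ, mfderivWithin_univ] at h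
  exact h

theorem fderiv_comp_extChartAt_symm {g : M → EuclideanSpace ℝ (Fin 4)} (x : M)
    {u : EuclideanSpace ℝ (Fin 2)} (hu : u ∈ (extChartAt (𝓡 2) x).target)
    (hg : MDifferentiableAt (𝓡 2) (𝓡 4) g ((extChartAt (𝓡 2) x).symm u)) :
    fderiv ℝ (g ∘ (extChartAt (𝓡 2) x).symm) u =
      (differential g ((extChartAt (𝓡 2) x).symm u)).comp (chartSymmDeriv x u) := by
  rw [← mfderiv_eq_fderiv]
  exact mfderiv_comp u hg ((contMDiffAt_extChartAt_symm' x hu).mdifferentiableAt (by simp))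

variable {f : M → EuclideanSpace ℝ (Fin 4)}

theorem fderiv_chartRep (hf : IsSmoothImmersion f) (x : M) {u : EuclideanSpace ℝ (Fin 2)}
    (hu : u ∈ (extChartAt (𝓡 2) x).target) : fderiv ℝ (chartRep f x) u =
      (differential f ((extChartAt (𝓡 2) x).symm u)).comp (chartSymmDeriv x u) :=
  fderiv_comp_extChartAt_symm x hu ((hf.1 _).mdifferentiableAt (by simp))

theorem injective_fderiv_chartRep (hf : IsSmoothImmersion f) (x : M)
    {u : EuclideanSpace ℝ (Fin 2)} (hu : u ∈ (extChartAt (𝓡 2) x).target) :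
    Function.Injective (fderiv ℝ (chartRep f x) u) := by
  rw [fderiv_chartRep hf x hu]
  obtain ⟨e, he⟩ := isInvertible_chartSymmDeriv x hu
  rw [← he]
  exact (hf.2 _).comp e.injective

theorem range_fderiv_chartRep (hf : IsSmoothImmersion f) (x : M) {u : EuclideanSpace ℝ (Fin 2)}
    (hu : u ∈ (extChartAt (𝓡 2) x).target) :
    LinearMap.range (fderiv ℝ (chartRep f x) u :
      EuclideanSpace ℝ (Fin 2) →ₗ[ℝ] EuclideanSpace ℝ (Fin 4)) =
      tangentPlane f ((extChartAt (𝓡 2) x).symm u) := by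
  rw [fderiv_chartRep hf x hu]
  obtain ⟨e, he⟩ := isInvertible_chartSymmDeriv x hu
  rw [← he]
  ext z
  constructor
  · rintro ⟨w, rfl⟩; exact ⟨e w, rfl⟩
  · rintro ⟨w, rfl⟩
    exact ⟨e.symm w, congrArg (differential f _) (e.apply_symm_apply w)⟩

theorem contDiffOn_chartRep (hf : IsSmoothImmersion f) (x : M) :
    ContDiffOn ℝ ∞ (chartRep f x) (extChartAt (𝓡 2) x).target := fun _ hu ↦
  (contDiffAt_chartRep hf x hu).contDiffWithinAt

variable {W : Submodule ℝ (EuclideanSpace ℝ (Fin 4))} {c₁ c₂ : ℝ}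

theorem exists_adaptedFrameOn_chart (hf : IsSmoothImmersion f) (hc : c₁ ^ 2 ≠ c₂ ^ 2)
    (hfr : ∀ p, ∃ a b, IsPrincipalFrame (tangentPlane f p) W c₁ c₂ a b) (x : M) :
    ∃ U ⊆ (extChartAt (𝓡 2) x).target, extChartAt (𝓡 2) x x ∈ U ∧
      ∃ e₁ e₂, AdaptedFrameOn (chartRep f x) W c₁ c₂ e₁ e₂ U :=
  exists_adaptedFrameOn hc (isOpen_extChartAt_target x) (contDiffOn_chartRep hf x)
    (fun _ hu ↦ injective_fderiv_chartRep hf x hu)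
    (fun _ hu ↦ by rw [range_fderiv_chartRep hf x hu]; exact hfr _) (mem_extChartAt_target x)

/-- The speed, in the direction `v`, at which the projection to `W` of the tangent plane rotates,
measured on the projection to `W` of the image of `v`. -/
noncomputable def tangentRotation (f : M → EuclideanSpace ℝ (Fin 4))
    (W : Submodule ℝ (EuclideanSpace ℝ (Fin 4))) (p : M) (v : EuclideanSpace ℝ (Fin 2)) : ℝ :=
  ‖differential (fun q ↦ W.starProjection
    ((tangentPlane f q).starProjection (W.starProjection (differential f p v)))) p v‖

omit [IsManifold (𝓡 2) ∞ M] in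
theorem tangentRotation_neg (p : M) (v : EuclideanSpace ℝ (Fin 2)) :
    tangentRotation f W p (-v) = tangentRotation f W p v := by
  unfold tangentRotation
  have h : (fun q ↦ W.starProjection
      ((tangentPlane f q).starProjection (W.starProjection (differential f p (-v))))) =
      -fun q ↦ W.starProjection
        ((tangentPlane f q).starProjection (W.starProjection (differential f p v))) := by
    funext q
    simp only [map_neg, Pi.neg_apply]
  have h2 : ∀ g : M → EuclideanSpace ℝ (Fin 4), differential (-g) p = -differential g p :=
    fun g ↦ mfderiv_neg
  rw [h, h2, map_neg, neg_apply, neg_neg]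

theorem tangentRotation_eq_rotationSpeed (hf : IsSmoothImmersion f) (x : M)
    {U : Set (EuclideanSpace ℝ (Fin 2))} (hU : U ⊆ (extChartAt (𝓡 2) x).target)
    {e₁ e₂ : EuclideanSpace ℝ (Fin 2) → EuclideanSpace ℝ (Fin 4)}
    (h : AdaptedFrameOn (chartRep f x) W c₁ c₂ e₁ e₂ U) {u v : EuclideanSpace ℝ (Fin 2)}
    (hu : u ∈ U) (hv : fderiv ℝ (chartRep f x) u v = e₁ u) :
    tangentRotation f W ((extChartAt (𝓡 2) x).symm u) (chartSymmDeriv x u v) =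
      rotationSpeed W e₁ e₂ u v := by
  have hz : differential f ((extChartAt (𝓡 2) x).symm u) (chartSymmDeriv x u v) = e₁ u := by
    rw [← hv, fderiv_chartRep hf x (hU hu)]; rfl
  unfold tangentRotation rotationSpeed
  rw [hz]
  set g : M → EuclideanSpace ℝ (Fin 4) := fun q ↦ W.starProjection
    ((tangentPlane f q).starProjection (W.starProjection (e₁ u))) with hg
  set g' : EuclideanSpace ℝ (Fin 2) → EuclideanSpace ℝ (Fin 4) := fun x ↦ W.starProjection
      (⟪e₁ x, W.starProjection (e₁ u)⟫_ℝ • e₁ x + ⟪e₂ x, W.starProjection (e₁ u)⟫_ℝ • e₂ x) with hg'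
  have heq : ∀ w ∈ U, g ((extChartAt (𝓡 2) x).symm w) = g' w := fun w hw ↦ by
    have hw' := h.frame w hw
    rw [range_fderiv_chartRep hf x (hU hw)] at hw'
    simp only [hg, hg', hw'.starProjection_apply]
  have hs : (extChartAt (𝓡 2) x).symm u ∈ (extChartAt (𝓡 2) x).source :=
    (extChartAt (𝓡 2) x).map_target (hU hu)
  have hr : extChartAt (𝓡 2) x ((extChartAt (𝓡 2) x).symm u) = u :=
    (extChartAt (𝓡 2) x).right_inv (hU hu)
  have hg'd : ContDiffAt ℝ ∞ g' u := by
    have h1 : ContDiffOn ℝ ∞ g' U := W.starProjection.contDiff.comp_contDiffOn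
      (((h.contDiffOn₁.inner ℝ contDiffOn_const).smul h.contDiffOn₁).add
        ((h.contDiffOn₂.inner ℝ contDiffOn_const).smul h.contDiffOn₂))
    exact h1.contDiffAt (h.isOpen.mem_nhds hu)
  have hφ : ContMDiffAt (𝓡 2) (𝓡 2) ∞ (extChartAt (𝓡 2) x) ((extChartAt (𝓡 2) x).symm u) :=
    contMDiffAt_extChartAt' (by rwa [extChartAt_source] at hs)
  have hgd : MDifferentiableAt (𝓡 2) (𝓡 4) g ((extChartAt (𝓡 2) x).symm u) := by
    have h1 : ContMDiffAt (𝓡 2) (𝓡 4) ∞ (g' ∘ extChartAt (𝓡 2) x)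
        ((extChartAt (𝓡 2) x).symm u) := by
      refine ContMDiffAt.comp (I' := 𝓡 2) _ ?_ hφ
      rw [hr]
      exact hg'd.contMDiffAt
    have h2 : g =ᶠ[𝓝 ((extChartAt (𝓡 2) x).symm u)] g' ∘ extChartAt (𝓡 2) x := by
      have hpre := hφ.continuousAt.preimage_mem_nhds (t := U) (by rw [hr]; exact h.isOpen.mem_nhds hu)
      filter_upwards [hpre, extChartAt_source_mem_nhds' hs] with q hq hqs
      rw [Function.comp_apply, ← heq _ hq, (extChartAt (𝓡 2) x).left_inv hqs]
    exact (h1.congr_of_eventuallyEq h2).mdifferentiableAt (by simp)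
  have hcomp : g ∘ (extChartAt (𝓡 2) x).symm =ᶠ[𝓝 u] g' := by
    filter_upwards [h.isOpen.mem_nhds hu] with w hw using heq w hw
  rw [← hcomp.fderiv_eq, fderiv_comp_extChartAt_symm x (hU hu) hgd]
  rfl

open Classical in
/-- The rotation speed of the tangent plane along its first principal direction. -/
noncomputable def principalRotation (f : M → EuclideanSpace ℝ (Fin 4))
    (W : Submodule ℝ (EuclideanSpace ℝ (Fin 4))) (c₁ c₂ : ℝ) (p : M) : ℝ :=
  if h : ∃ v b, IsPrincipalFrame (tangentPlane f p) W c₁ c₂ (differential f p v) b then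
    tangentRotation f W p h.choose else 0

omit [IsManifold (𝓡 2) ∞ M] in
theorem principalRotation_nonneg (p : M) : 0 ≤ principalRotation f W c₁ c₂ p := by
  unfold principalRotation
  split_ifs
  exacts [norm_nonneg _, le_rfl]

omit [IsManifold (𝓡 2) ∞ M] in
theorem principalRotation_eq (hf : IsSmoothImmersion f) (hc : c₁ ^ 2 ≠ c₂ ^ 2) {p : M}
    {v : EuclideanSpace ℝ (Fin 2)} {b : EuclideanSpace ℝ (Fin 4)}
    (h : IsPrincipalFrame (tangentPlane f p) W c₁ c₂ (differential f p v) b) :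
    principalRotation f W c₁ c₂ p = tangentRotation f W p v := by
  have hex : ∃ v b, IsPrincipalFrame (tangentPlane f p) W c₁ c₂ (differential f p v) b :=
    ⟨v, b, h⟩
  rw [principalRotation, dif_pos hex]
  obtain ⟨b', hb'⟩ := hex.choose_spec
  rcases h.eq_or_eq_neg hc hb' with h' | h'
  · rw [hf.2 p h']
  · rw [← map_neg] at h'
    rw [hf.2 p h', tangentRotation_neg]

theorem principalRotation_eq_rotationSpeed (hf : IsSmoothImmersion f) (hc : c₁ ^ 2 ≠ c₂ ^ 2)
    (x : M) {U : Set (EuclideanSpace ℝ (Fin 2))} (hU : U ⊆ (extChartAt (𝓡 2) x).target)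
    {e₁ e₂ : EuclideanSpace ℝ (Fin 2) → EuclideanSpace ℝ (Fin 4)}
    (h : AdaptedFrameOn (chartRep f x) W c₁ c₂ e₁ e₂ U) {u v : EuclideanSpace ℝ (Fin 2)}
    (hu : u ∈ U) (hv : fderiv ℝ (chartRep f x) u v = e₁ u) :
    principalRotation f W c₁ c₂ ((extChartAt (𝓡 2) x).symm u) = rotationSpeed W e₁ e₂ u v := by
  rw [← tangentRotation_eq_rotationSpeed hf x hU h hu hv]
  have hfr := h.frame u hu
  rw [range_fderiv_chartRep hf x (hU hu), ← hv, fderiv_chartRep hf x (hU hu)] at hfr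
  exact principalRotation_eq hf hc hfr

end Chart

section Descent

variable {M : Type*} [TopologicalSpace M] [ChartedSpace (EuclideanSpace ℝ (Fin 2)) M]
  [IsManifold (𝓡 2) ∞ M] {f : M → EuclideanSpace ℝ (Fin 4)}

theorem inducedEDist_self (hf : IsSmoothImmersion f) (x : M) : inducedEDist f x x = 0 := by
  have hx := mem_extChartAt_target (I := 𝓡 2) x
  have h := inducedEDist_chart_segment_le hf x (u := extChartAt (𝓡 2) x x)
    (w := extChartAt (𝓡 2) x x) (C := 0)
    (by rw [segment_same]; exact singleton_subset_iff.2 hx) (fun z _ ↦ by simp)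
  rw [extChartAt_to_inv] at h
  simpa using h

theorem continuousAt_fderiv_chartRep (hf : IsSmoothImmersion f) (x : M) :
    ContinuousAt (fderiv ℝ (chartRep f x)) (extChartAt (𝓡 2) x x) :=
  ((contDiffAt_chartRep hf x (mem_extChartAt_target x)).fderiv_right (m := ∞)
    (by simp)).continuousAt

theorem tendsto_inducedEDist (hf : IsSmoothImmersion f) (x : M) :
    Tendsto (fun y ↦ inducedEDist f y x) (𝓝 x) (𝓝 0) := by
  set u₀ := extChartAt (𝓡 2) x x with hu₀
  set C := ‖fderiv ℝ (chartRep f x) u₀‖ + 1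
  have hev : ∀ᶠ z in 𝓝 u₀, z ∈ (extChartAt (𝓡 2) x).target ∧
      ‖fderiv ℝ (chartRep f x) z‖ < C :=
    (eventually_mem_set.2 (extChartAt_target_mem_nhds (I := 𝓡 2) x)).and
      ((continuousAt_fderiv_chartRep hf x).norm.eventually_lt_const (lt_add_one _))
  obtain ⟨r, hr, hball⟩ := Metric.eventually_nhds_iff_ball.1 hev
  have hlim : Tendsto (fun y : M ↦ ENNReal.ofReal (C * ‖extChartAt (𝓡 2) x y - u₀‖)) (𝓝 x)
      (𝓝 0) := by
    have h1 : Tendsto (fun y : M ↦ C * ‖extChartAt (𝓡 2) x y - u₀‖) (𝓝 x)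
        (𝓝 (C * ‖u₀ - u₀‖)) :=
      (((continuousAt_extChartAt (I := 𝓡 2) x).sub_const u₀).norm).const_mul C
    simpa using ENNReal.tendsto_ofReal h1
  refine tendsto_of_tendsto_of_tendsto_of_le_of_le' tendsto_const_nhds hlim
    (Eventually.of_forall fun _ ↦ zero_le) ?_
  filter_upwards [extChartAt_source_mem_nhds (I := 𝓡 2) x,
    (continuousAt_extChartAt (I := 𝓡 2) x).preimage_mem_nhds (Metric.ball_mem_nhds _ hr)]
    with y hys hyb
  have hsub : segment ℝ u₀ (extChartAt (𝓡 2) x y) ⊆ Metric.ball u₀ r :=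
    (convex_ball u₀ r).segment_subset (Metric.mem_ball_self hr) hyb
  have h := inducedEDist_chart_segment_le hf x (C := C * ‖extChartAt (𝓡 2) x y - u₀‖)
    (fun z hz ↦ (hball z (hsub hz)).1) fun z hz ↦ ((fderiv ℝ (chartRep f x) z).le_opNorm _).trans
      (mul_le_mul_of_nonneg_right (hball z (hsub hz)).2.le (norm_nonneg _))
  rw [inducedEDist_comm hf]
  rwa [hu₀, extChartAt_to_inv, (extChartAt (𝓡 2) x).left_inv hys] at h

/-- Moving along a straight line in the chart, with initial speed `1`. -/
theorem eventually_inducedEDist_le (hf : IsSmoothImmersion f) (x : M)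
    {Y : EuclideanSpace ℝ (Fin 2)}
    (hY : ‖fderiv ℝ (chartRep f x) (extChartAt (𝓡 2) x x) Y‖ = 1) :
    ∀ᶠ t in 𝓝[>] (0 : ℝ), inducedEDist f x ((extChartAt (𝓡 2) x).symm
      (extChartAt (𝓡 2) x x + t • Y)) ≤ ENNReal.ofReal (2 * t) := by
  set u₀ := extChartAt (𝓡 2) x x with hu₀
  have hcont : ContinuousAt (fun z ↦ fderiv ℝ (chartRep f x) z Y) u₀ :=
    (continuousAt_fderiv_chartRep hf x).clm_apply continuousAt_const
  have hev : ∀ᶠ z in 𝓝 u₀, z ∈ (extChartAt (𝓡 2) x).target ∧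
      ‖fderiv ℝ (chartRep f x) z Y‖ < 2 :=
    (eventually_mem_set.2 (extChartAt_target_mem_nhds (I := 𝓡 2) x)).and
      (hcont.norm.eventually_lt_const (by beta_reduce; rw [hY]; exact one_lt_two))
  obtain ⟨r, hr, hball⟩ := Metric.eventually_nhds_iff_ball.1 hev
  have hline : ContinuousAt (fun t : ℝ ↦ u₀ + t • Y) 0 := by fun_prop
  have hpre := hline.preimage_mem_nhds (t := Metric.ball u₀ r)
    (by simpa using Metric.ball_mem_nhds u₀ hr)
  filter_upwards [nhdsWithin_le_nhds hpre, self_mem_nhdsWithin] with t htb ht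
  have hsub : segment ℝ u₀ (u₀ + t • Y) ⊆ Metric.ball u₀ r :=
    (convex_ball u₀ r).segment_subset (Metric.mem_ball_self hr) htb
  have h := inducedEDist_chart_segment_le hf x (C := 2 * t)
    (fun z hz ↦ (hball z (hsub hz)).1) fun z hz ↦ by
      rw [add_sub_cancel_left, map_smul, norm_smul, Real.norm_of_nonneg (le_of_lt ht), mul_comm]
      exact mul_le_mul_of_nonneg_right (hball z (hsub hz)).2.le (le_of_lt ht)
  rwa [hu₀, extChartAt_to_inv] at h

variable {W : Submodule ℝ (EuclideanSpace ℝ (Fin 4))} {c₁ s₁ c₂ s₂ : ℝ}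

theorem finrank_orthogonal_eq_two (hW : Module.finrank ℝ W = 2) : Module.finrank ℝ Wᗮ = 2 := by
  have := W.finrank_add_finrank_orthogonal
  rw [hW, finrank_euclideanSpace_fin] at this
  omega

theorem exists_riccati_chart (hf : IsSmoothImmersion f) (hW : Module.finrank ℝ W = 2)
    (hc₁ : 0 < c₁) (hs₁ : 0 < s₁) (hc₂ : 0 < c₂) (hs₂ : 0 < s₂)
    (h₁ : c₁ ^ 2 + s₁ ^ 2 = 1) (h₂ : c₂ ^ 2 + s₂ ^ 2 = 1) (hc : c₁ ^ 2 ≠ c₂ ^ 2)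
    (hfr : ∀ p, ∃ a b, IsPrincipalFrame (tangentPlane f p) W c₁ c₂ a b) (x : M) :
    ∃ (a : EuclideanSpace ℝ (Fin 2) → ℝ) (Y : EuclideanSpace ℝ (Fin 2)),
      DifferentiableAt ℝ a (extChartAt (𝓡 2) x x) ∧
      ‖fderiv ℝ (chartRep f x) (extChartAt (𝓡 2) x x) Y‖ = 1 ∧
      fderiv ℝ a (extChartAt (𝓡 2) x x) Y =
        -(s₂ * c₂ / (c₁ ^ 2 - c₂ ^ 2)) * a (extChartAt (𝓡 2) x x) ^ 2 ∧
      ∀ᶠ u in 𝓝 (extChartAt (𝓡 2) x x),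
        principalRotation f W c₁ c₂ ((extChartAt (𝓡 2) x).symm u) = c₁ ^ 2 * s₂ * |a u| := by
  obtain ⟨U, hUt, hu₀, e₁, e₂, h⟩ := exists_adaptedFrameOn_chart hf hc hfr x
  obtain ⟨a, had, haY, hav⟩ := h.exists_riccati hW (finrank_orthogonal_eq_two hW) hc₁ hs₁ hc₂ hs₂
    h₁ h₂ hc hu₀
  obtain ⟨Y, hY⟩ := (h.frame _ hu₀).mem₂
  change fderiv ℝ (chartRep f x) _ Y = _ at hY
  refine ⟨a, Y, had, by rw [hY, (h.frame _ hu₀).norm₂], haY Y hY, ?_⟩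
  filter_upwards [hav, h.isOpen.mem_nhds hu₀] with u hu huU
  obtain ⟨v, hv⟩ := (h.frame u huU).mem₁
  rw [principalRotation_eq_rotationSpeed hf hc x hUt h huU hv, hu v hv]

theorem continuous_principalRotation (hf : IsSmoothImmersion f) (hW : Module.finrank ℝ W = 2)
    (hc₁ : 0 < c₁) (hs₁ : 0 < s₁) (hc₂ : 0 < c₂) (hs₂ : 0 < s₂)
    (h₁ : c₁ ^ 2 + s₁ ^ 2 = 1) (h₂ : c₂ ^ 2 + s₂ ^ 2 = 1) (hc : c₁ ^ 2 ≠ c₂ ^ 2)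
    (hfr : ∀ p, ∃ a b, IsPrincipalFrame (tangentPlane f p) W c₁ c₂ a b) :
    Continuous (principalRotation f W c₁ c₂) := by
  refine continuous_iff_continuousAt.2 fun x ↦ ?_
  obtain ⟨a, Y, had, -, -, hav⟩ := exists_riccati_chart hf hW hc₁ hs₁ hc₂ hs₂ h₁ h₂ hc hfr x
  have hφ := continuousAt_extChartAt (I := 𝓡 2) x
  have h1 : ContinuousAt (fun y ↦ c₁ ^ 2 * s₂ * |a (extChartAt (𝓡 2) x y)|) x :=
    (ContinuousAt.comp (f := extChartAt (𝓡 2) x) had.continuousAt hφ).abs.const_mul _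
  refine h1.congr ?_
  filter_upwards [hφ.eventually hav, extChartAt_source_mem_nhds (I := 𝓡 2) x] with y hy hys
  rw [← hy, (extChartAt (𝓡 2) x).left_inv hys]

/-- Along a straight line, a differentiable function `a` with derivative `A a ^ 2` satisfies that
`1 / |a|` decreases at a rate at least `|A| / 2` in one of the two directions. -/
theorem exists_direction_inv_abs_le {V : Type*} [NormedAddCommGroup V] [NormedSpace ℝ V]
    {a : V → ℝ} {u₀ Y : V} {A : ℝ} (ha : DifferentiableAt ℝ a u₀) (ha0 : a u₀ ≠ 0) (hA : A ≠ 0)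
    (hY : fderiv ℝ a u₀ Y = A * a u₀ ^ 2) : ∃ Z, (Z = Y ∨ Z = -Y) ∧
      ∀ᶠ t in 𝓝[>] (0 : ℝ), a (u₀ + t • Z) ≠ 0 ∧
        |A| / 2 * t < |a u₀|⁻¹ - |a (u₀ + t • Z)|⁻¹ := by
  obtain ⟨σ, hσ, hσa⟩ : ∃ σ : ℝ, (σ = 1 ∨ σ = -1) ∧ σ * a u₀ = |a u₀| := by
    rcases abs_choice (a u₀) with h | h
    · exact ⟨1, Or.inl rfl, by rw [h, one_mul]⟩
    · exact ⟨-1, Or.inr rfl, by rw [h, neg_one_mul]⟩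
  obtain ⟨Z, hZ, hZa⟩ : ∃ Z, (Z = Y ∨ Z = -Y) ∧ σ * fderiv ℝ a u₀ Z = |A| * a u₀ ^ 2 := by
    rcases hσ with rfl | rfl <;> rcases abs_choice A with h | h
    · exact ⟨Y, Or.inl rfl, by rw [h, hY]; ring⟩
    · exact ⟨-Y, Or.inr rfl, by rw [h, map_neg, hY]; ring⟩
    · exact ⟨-Y, Or.inr rfl, by rw [h, map_neg, hY]; ring⟩
    · exact ⟨Y, Or.inl rfl, by rw [h, hY]; ring⟩
  refine ⟨Z, hZ, ?_⟩
  have hpos : 0 < |a u₀| := abs_pos.2 ha0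
  have hline : HasDerivAt (fun t : ℝ ↦ u₀ + t • Z) Z 0 := by
    simpa using ((hasDerivAt_id (0 : ℝ)).smul_const Z).const_add u₀
  have hb : HasDerivAt (fun t : ℝ ↦ σ * a (u₀ + t • Z)) (|A| * a u₀ ^ 2) 0 := by
    rw [← hZa]
    refine HasDerivAt.const_mul σ (HasFDerivAt.comp_hasDerivAt (l := a) (0 : ℝ) ?_ hline)
    simpa using ha.hasFDerivAt
  have hb0 : σ * a (u₀ + (0 : ℝ) • Z) = |a u₀| := by rw [zero_smul, add_zero, hσa]
  have hinv : HasDerivAt (fun t : ℝ ↦ (σ * a (u₀ + t • Z))⁻¹) (-|A|) 0 := by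
    have := hb.fun_inv (by rw [hb0]; exact hpos.ne')
    rwa [hb0, sq_abs, neg_div, mul_div_cancel_right₀ _ (pow_ne_zero 2 ha0)] at this
  have hslope := (hasDerivAt_iff_tendsto_slope_zero.1 hinv).mono_left
    (nhdsWithin_mono (0 : ℝ) (show Ioi (0 : ℝ) ⊆ {0}ᶜ from fun t ht ↦ ne_of_gt ht))
  have hlt : -|A| < -(|A| / 2) := by linarith [abs_pos.2 hA]
  have hbpos : ∀ᶠ t in 𝓝[>] (0 : ℝ), 0 < σ * a (u₀ + t • Z) :=
    nhdsWithin_le_nhds (hb.continuousAt.eventually_const_lt (by beta_reduce; rw [hb0]; exact hpos))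
  filter_upwards [hslope.eventually_lt_const hlt, hbpos, self_mem_nhdsWithin] with t h1 h2 h3
  have habs : |a (u₀ + t • Z)| = σ * a (u₀ + t • Z) := by
    rw [← abs_of_pos h2, abs_mul]
    rcases hσ with rfl | rfl <;> simp
  refine ⟨fun h0 ↦ by simp [h0] at h2, ?_⟩
  rw [zero_add, hb0, smul_eq_mul, inv_mul_lt_iff₀ h3] at h1
  rw [habs]
  linarith

theorem principalRotation_eq_zero (hf : IsSmoothImmersion f) (hcomplete : IsCompleteSurface f)
    (hW : Module.finrank ℝ W = 2)
    (hc₁ : 0 < c₁) (hs₁ : 0 < s₁) (hc₂ : 0 < c₂) (hs₂ : 0 < s₂)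
    (h₁ : c₁ ^ 2 + s₁ ^ 2 = 1) (h₂ : c₂ ^ 2 + s₂ ^ 2 = 1) (hc : c₁ ^ 2 ≠ c₂ ^ 2)
    (hfr : ∀ p, ∃ a b, IsPrincipalFrame (tangentPlane f p) W c₁ c₂ a b) (p : M) :
    principalRotation f W c₁ c₂ p = 0 := by
  set A := -(s₂ * c₂ / (c₁ ^ 2 - c₂ ^ 2)) with hA
  have hA0 : A ≠ 0 := neg_ne_zero.2 (div_ne_zero (by positivity) (sub_ne_zero.2 hc))
  set K := c₁ ^ 2 * s₂ with hK
  have hK0 : 0 < K := by positivity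
  have hAp := abs_pos.2 hA0
  set ε := |A| / (4 * K) with hε
  have hε0 : 0 < ε := by positivity
  have key : ε * principalRotation f W c₁ c₂ p = 0 := by
    refine eq_zero_of_descent (inducedEDist f) (inducedEDist_self hf) (inducedEDist_comm hf)
      (inducedEDist_triangle hf) (tendsto_inducedEDist hf) hcomplete
      (G := fun x ↦ ε * principalRotation f W c₁ c₂ x)
      ((continuous_principalRotation hf hW hc₁ hs₁ hc₂ hs₂ h₁ h₂ hc hfr).const_mul ε)
      (fun x ↦ mul_nonneg hε0.le (principalRotation_nonneg x)) (fun x hx ↦ ?_) p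
    obtain ⟨a, Y, had, hY1, hYa, hav⟩ := exists_riccati_chart hf hW hc₁ hs₁ hc₂ hs₂ h₁ h₂ hc hfr x
    set u₀ := extChartAt (𝓡 2) x x with hu₀
    have hx' : principalRotation f W c₁ c₂ x = K * |a u₀| := by
      have := hav.self_of_nhds
      rwa [hu₀, extChartAt_to_inv] at this
    have ha0 : a u₀ ≠ 0 := by
      intro h0
      simp [hx', h0] at hx
    obtain ⟨Z, hZ, hZt⟩ := exists_direction_inv_abs_le had ha0 hA0 hYa
    have hZ1 : ‖fderiv ℝ (chartRep f x) u₀ Z‖ = 1 := by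
      rcases hZ with rfl | rfl
      · exact hY1
      · rw [map_neg, norm_neg, hY1]
    have hline : Tendsto (fun t : ℝ ↦ u₀ + t • Z) (𝓝[>] 0) (𝓝 u₀) := by
      have : ContinuousAt (fun t : ℝ ↦ u₀ + t • Z) 0 := by fun_prop
      simpa using this.tendsto.mono_left (nhdsWithin_le_nhds (s := Ioi 0))
    obtain ⟨t, ⟨hat, hrate⟩, hd, hpr, ht⟩ := (hZt.and ((eventually_inducedEDist_le hf x hZ1).and
      ((hline.eventually hav).and self_mem_nhdsWithin))).exists
    have ht0 : 0 < t := ht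
    have hKε : ∀ z : ℝ, (ε * (K * |z|))⁻¹ = 4 / |A| * |z|⁻¹ := by
      intro z
      rw [hε, ← mul_assoc, mul_inv]
      congr 1
      field_simp
    have hdiff : 2 * t < (ε * (K * |a u₀|))⁻¹ - (ε * (K * |a (u₀ + t • Z)|))⁻¹ := by
      rw [hKε, hKε, ← mul_sub]
      calc 2 * t = 4 / |A| * (|A| / 2 * t) := by field_simp; ring
        _ < _ := mul_lt_mul_of_pos_left hrate (by positivity)
    refine ⟨(extChartAt (𝓡 2) x).symm (u₀ + t • Z), ?_, ?_, ?_⟩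
    · beta_reduce
      rw [hpr]
      have := abs_pos.2 hat
      positivity
    · beta_reduce
      rw [hpr, hx']
      linarith
    · beta_reduce
      rw [hpr, hx']
      exact hd.trans (ENNReal.ofReal_le_ofReal hdiff.le)
  exact (mul_eq_zero.1 key).resolve_left hε0.ne'

theorem isTotallyGeodesic_of_isPrincipalFrame (hf : IsSmoothImmersion f)
    (hcomplete : IsCompleteSurface f) (hW : Module.finrank ℝ W = 2)
    (hc₁ : 0 < c₁) (hs₁ : 0 < s₁) (hc₂ : 0 < c₂) (hs₂ : 0 < s₂)
    (h₁ : c₁ ^ 2 + s₁ ^ 2 = 1) (h₂ : c₂ ^ 2 + s₂ ^ 2 = 1) (hc : c₁ ^ 2 ≠ c₂ ^ 2)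
    (hfr : ∀ p, ∃ a b, IsPrincipalFrame (tangentPlane f p) W c₁ c₂ a b) :
    IsTotallyGeodesic f := by
  intro p v w
  obtain ⟨U, hUt, hu₀, e₁, e₂, h⟩ := exists_adaptedFrameOn_chart hf hc hfr p
  have hfr' : ∀ p, ∃ a b, IsPrincipalFrame (tangentPlane f p) W c₂ c₁ a b := fun p ↦
    let ⟨a, b, hab⟩ := hfr p; ⟨b, a, hab.swap⟩
  have hmem := h.fderiv_fderiv_mem hW (finrank_orthogonal_eq_two hW) hc₁ hs₁ hc₂ hs₂ h₁ h₂ hc hu₀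
    (fun X hX ↦ by
      rw [← principalRotation_eq_rotationSpeed hf hc p hUt h hu₀ hX]
      exact principalRotation_eq_zero hf hcomplete hW hc₁ hs₁ hc₂ hs₂ h₁ h₂ hc hfr _)
    (fun X hX ↦ by
      rw [← principalRotation_eq_rotationSpeed hf hc.symm p hUt h.swap hu₀ hX]
      exact principalRotation_eq_zero hf hcomplete hW hc₂ hs₂ hc₁ hs₁ h₂ h₁ hc.symm hfr' _) v w
  rw [range_fderiv_chartRep hf p (hUt hu₀), extChartAt_to_inv] at hmem
  exact (Submodule.starProjection_apply_eq_zero_iff _).2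
    ((Submodule.le_orthogonal_orthogonal _) hmem)

end Descent

end ConstantAngleSurface

theorem mainTheorem2 {M : Type*} [TopologicalSpace M] [T2Space M]
    [ChartedSpace (EuclideanSpace ℝ (Fin 2)) M] [IsManifold (𝓡 2) ∞ M]
    (f : M → EuclideanSpace ℝ (Fin 4))
    (hf : ConstantAngleSurface.IsSmoothImmersion f)
    (hcomplete : ConstantAngleSurface.IsCompleteSurface f)
    (Pl : Submodule ℝ (EuclideanSpace ℝ (Fin 4))) (hPl : Module.finrank ℝ Pl = 2)
    (θ₁ θ₂ : ℝ) (h₁ : 0 < θ₁) (h₁₂ : θ₁ < θ₂) (h₂ : θ₂ < Real.pi / 2)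
    (hangles : ConstantAngleSurface.HasConstantPrincipalAngles f Pl θ₁ θ₂) :
    ConstantAngleSurface.IsTotallyGeodesic f := by
  have hpi := Real.pi_pos
  have hc₁ : 0 < Real.cos θ₁ := Real.cos_pos_of_mem_Ioo ⟨by linarith, by linarith⟩
  have hc₂ : 0 < Real.cos θ₂ := Real.cos_pos_of_mem_Ioo ⟨by linarith, by linarith⟩
  have hs₁ : 0 < Real.sin θ₁ := Real.sin_pos_of_pos_of_lt_pi h₁ (by linarith)
  have hs₂ : 0 < Real.sin θ₂ := Real.sin_pos_of_pos_of_lt_pi (by linarith) (by linarith)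
  have hlt : Real.cos θ₂ < Real.cos θ₁ :=
    Real.cos_lt_cos_of_nonneg_of_le_pi_div_two h₁.le h₂.le h₁₂
  refine ConstantAngleSurface.isTotallyGeodesic_of_isPrincipalFrame hf hcomplete hPl hc₁ hs₁ hc₂
    hs₂ (Real.cos_sq_add_sin_sq θ₁) (Real.cos_sq_add_sin_sq θ₂)
    (pow_lt_pow_left₀ hlt hc₂.le two_ne_zero).ne' fun p ↦ ?_
  refine ConstantAngleSurface.exists_isPrincipalFrame ?_ hPl (hangles p)
  rw [ConstantAngleSurface.tangentPlane, LinearMap.finrank_range_of_inj (hf.2 p),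
    finrank_euclideanSpace_fin]
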